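/- Let $n\ge 1$, $z=(z',z_n)\in\mathbb C^{n-1}\times\mathbb C$, and let $T_B=\{z=x+iy\in\mathbb C^n:\ y_1^2+\dots+y_{n-1}^2<y_n\}$. Put $\rho(z,w)=\frac14\big((z'-\overline{w'})^2-2i(z_n-\overline{w_n})\big)$, where $u^2=\sum_k u_k^2$, put $\rho(z)=\rho(z,z)=y_n-|y'|^2$, and let $\mathbf i=(0',i)$. For $\alpha>-1$ let $dV_\alpha=\rho(z)^\alpha dV$ with $V$ the Lebesgue measure on $\mathbb C^n$, and let $A^p_\alpha(T_B)$ be the space of holomorphic functions $f$ on $T_B$ with $\|f\|_{p,\alpha}=\big(\int_{T_B}|f|^p\,dV_\alpha\big)^{1/p}<\infty$. Let $$K_\alpha(z,w)=\frac{\Gamma(n+\alpha+1)}{2^{n+1}\pi^n\,\Gamma(\alpha+1)\,\rho(z,w)^{n+\alpha+1}}$$ (principal branch). For a positive Borel measure $\mu$ on $T_B$ the Toeplitz operator is $$T_\mu f(z)=\int_{T_B}K_\alpha(z,w)f(w)\,d\mu(w),\qquad z\in T_B,$$ with domain the set of all $f\in A^p_\alpha(T_B)$ for which this integral converges absolutely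 for every $z\in T_B$. Let $\mathcal M_+$ be the set of positive Borel measures $\mu$ on $T_B$ such that $\int_{T_B}|\rho(z,\mathbf i)|^{-s}\,d\mu(z)<\infty$ for some $s>0$. For $t\in\mathbb R$ let $S_t$ be the space of holomorphic functions $f$ on $T_B$ with $\sup_{z\in T_B}|\rho(z,\mathbf i)|^t|f(z)|<\infty$. **Theorem.** Let $1\le p<\infty$, $\alpha>-1$, $t>n+(\alpha+1)/p$ and $\mu\in\mathcal M_+$. Then: 1. $S_t$ is contained in $A^p_\alpha(T_B)$ and is dense in it. 2. $T_\mu$ is densely defined on $A^p_\alpha(T_B)$, that is, its domain is dense in $A^p_\alpha(T_B)$; moreover $T_\mu f$ is holomorphic on $T_B$ for every $f$ in the domain. 3. If $\int_{T_B}|\rho(z,\mathbf i)|^{-t}\,d\mu(z)<\infty$, then $S_t$ is contained in the domain of $T_\mu$. Moreover, there is $s_0\in\mathbb R$ such that, for every $s\ge s_0$, $S_s\cap A^p_\alpha(T_B)$ is contained in the domain of $T_\mu$. -/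

import Mathlib

open MeasureTheory

noncomputable section

/- Complex `n`-space is `Fin (m + 1) → ℂ`, where `n = m + 1 ≥ 1`.  The last coordinate of `z` is
`z (Fin.last m)`, and `z'` consists of the coordinates `z k.castSucc`, `k : Fin m`. -/

/-- The base `B = {y ∈ ℝⁿ : y₁² + ⋯ + yₙ₋₁² < yₙ}`. -/
def tubeBase (m : ℕ) : Set (Fin (m + 1) → ℝ) :=
  {y | ∑ k : Fin m, (y k.castSucc) ^ 2 < y (Fin.last m)}

/-- The tubular domain `T_B = {x + iy : x ∈ ℝⁿ, y ∈ B}`. -/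
def tube (m : ℕ) : Set (Fin (m + 1) → ℂ) :=
  {z | (fun k => (z k).im) ∈ tubeBase m}

/-- `ρ(z, w) = ¼ ((z' - w̄')² - 2i (zₙ - w̄ₙ))`, where `u² = ∑ uₖ²`. -/
def rho {m : ℕ} (z w : Fin (m + 1) → ℂ) : ℂ :=
  (1 / 4) * (∑ k : Fin m, (z k.castSucc - (starRingEnd ℂ) (w k.castSucc)) ^ 2
    - 2 * Complex.I * (z (Fin.last m) - (starRingEnd ℂ) (w (Fin.last m))))

/-- `ρ(z) = yₙ - |y'|²`, where `y = Im z`. -/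
def rhoDiag {m : ℕ} (z : Fin (m + 1) → ℂ) : ℝ :=
  (z (Fin.last m)).im - ∑ k : Fin m, ((z k.castSucc).im) ^ 2

/-- The base point `𝐢 = (0', i)`. -/
def basePt (m : ℕ) : Fin (m + 1) → ℂ := Pi.single (Fin.last m) Complex.I

/-- The measure `dV_α = ρ(z)^α dV` on `T_B`, with `V` the Lebesgue measure of `ℂⁿ`. -/
def weightedVolume (m : ℕ) (α : ℝ) : Measure (Fin (m + 1) → ℂ) :=
  (volume.restrict (tube m)).withDensity fun z => ENNReal.ofReal (rhoDiag z ^ α)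

/-- The Bergman space `A^p_α(T_B)`: functions holomorphic on `T_B` with finite `L^p(dV_α)` norm.
Functions are total; their values off `T_B` are irrelevant. -/
def bergmanSpace (m : ℕ) (p α : ℝ) : Submodule ℂ ((Fin (m + 1) → ℂ) → ℂ) where
  carrier := {f | DifferentiableOn ℂ f (tube m) ∧
    MemLp f (ENNReal.ofReal p) (weightedVolume m α)}
  zero_mem' := ⟨differentiableOn_const 0, MemLp.zero⟩
  add_mem' hf hg := ⟨hf.1.add hg.1, hf.2.add hg.2⟩
  smul_mem' c _ hf := ⟨hf.1.const_smul c, hf.2.const_smul c⟩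

/-- Density of a subspace `D` of `A^p_α(T_B)` for the norm `‖·‖_{p,α}`. -/
def IsDenseInBergman {m : ℕ} {p α : ℝ} (D : Submodule ℂ (bergmanSpace m p α)) : Prop :=
  ∀ f : bergmanSpace m p α, ∀ ε : ℝ, 0 < ε → ∃ g ∈ D,
    eLpNorm (fun z => f.1 z - g.1 z) (ENNReal.ofReal p) (weightedVolume m α) < ENNReal.ofReal ε

/-- The space `S_t` of functions holomorphic on `T_B` for which `|ρ(z, 𝐢)|^t |f(z)|` is bounded
on `T_B`. -/
def decaySpace (m : ℕ) (t : ℝ) : Submodule ℂ ((Fin (m + 1) → ℂ) → ℂ) where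
  carrier := {f | DifferentiableOn ℂ f (tube m) ∧
    ∃ C : ℝ, ∀ z ∈ tube m, ‖rho z (basePt m)‖ ^ t * ‖f z‖ ≤ C}
  zero_mem' := ⟨differentiableOn_const 0, 0, fun z _ => by simp⟩
  add_mem' := by
    rintro f g ⟨hf, C, hC⟩ ⟨hg, C', hC'⟩
    refine ⟨hf.add hg, C + C', fun z hz => ?_⟩
    calc ‖rho z (basePt m)‖ ^ t * ‖(f + g) z‖
        ≤ ‖rho z (basePt m)‖ ^ t * (‖f z‖ + ‖g z‖) := by
          gcongr
          exact norm_add_le _ _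
      _ = ‖rho z (basePt m)‖ ^ t * ‖f z‖ + ‖rho z (basePt m)‖ ^ t * ‖g z‖ := mul_add _ _ _
      _ ≤ C + C' := add_le_add (hC z hz) (hC' z hz)
  smul_mem' := by
    rintro c f ⟨hf, C, hC⟩
    refine ⟨hf.const_smul c, ‖c‖ * C, fun z hz => ?_⟩
    have h := mul_le_mul_of_nonneg_left (hC z hz) (norm_nonneg c)
    simp only [Pi.smul_apply, smul_eq_mul, norm_mul]
    linarith

/-- The integral of `|ρ(w, 𝐢)|^{-t}` over `T_B` with respect to `μ` is finite. -/
def FiniteMoment {m : ℕ} (μ : Measure (Fin (m + 1) → ℂ)) (t : ℝ) : Prop :=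
  ∫⁻ w in tube m, ENNReal.ofReal (1 / ‖rho w (basePt m)‖ ^ t) ∂μ < ⊤

/-- The class `M_+` of positive Borel measures on `T_B` (only the restriction of `μ` to `T_B`
plays a role). -/
def MPlus (m : ℕ) : Set (Measure (Fin (m + 1) → ℂ)) :=
  {μ | ∃ t : ℝ, 0 < t ∧ FiniteMoment μ t}

/-- The weighted Bergman kernel
`K_α(z, w) = Γ(n + α + 1) / (2^{n+1} π^n Γ(α + 1) ρ(z, w)^{n + α + 1})`, `n = m + 1`
(principal branch of the power). -/
def bergmanKernel {m : ℕ} (α : ℝ) (z w : Fin (m + 1) → ℂ) : ℂ :=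
  ((Real.Gamma ((m + 1 : ℝ) + α + 1) : ℝ) : ℂ) /
    ((((2 : ℝ) ^ (m + 2) * Real.pi ^ (m + 1) * Real.Gamma (α + 1) : ℝ) : ℂ) *
      rho z w ^ ((((m + 1 : ℝ) + α + 1 : ℝ)) : ℂ))

/-- The Toeplitz operator `T_μ f (z) = ∫_{T_B} K_α(z, w) f(w) dμ(w)`, `z ∈ T_B`, as a partially
defined linear operator on `A^p_α(T_B)`: its domain consists of all `f` for which the integral
converges absolutely for every `z ∈ T_B`.  Values of `T_μ f` off `T_B` are set to zero. -/
def toeplitz {m : ℕ} (p α : ℝ) (μ : Measure (Fin (m + 1) → ℂ)) :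
    bergmanSpace m p α →ₗ.[ℂ] ((Fin (m + 1) → ℂ) → ℂ) where
  domain :=
    { carrier := {f | ∀ z ∈ tube m,
        Integrable (fun w => bergmanKernel α z w * f.1 w) (μ.restrict (tube m))}
      zero_mem' := fun z _ => by simp
      add_mem' := fun {f g} hf hg z hz =>
        ((hf z hz).add (hg z hz)).congr (ae_of_all _ fun w => by simp [mul_add])
      smul_mem' := fun c f hf z hz => by
        simpa [mul_left_comm] using (hf z hz).const_mul c }
  toFun :=
    { toFun := fun f => (tube m).indicator fun z =>
        ∫ w in tube m, bergmanKernel α z w * f.1.1 w ∂μ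
      map_add' := fun f g => by
        ext z
        by_cases hz : z ∈ tube m
        · simp only [Set.indicator_of_mem hz, Pi.add_apply]
          rw [← integral_add (f.2 z hz) (g.2 z hz)]
          simp [mul_add]
        · simp [hz]
      map_smul' := fun c f => by
        ext z
        by_cases hz : z ∈ tube m
        · simp only [Set.indicator_of_mem hz, Pi.smul_apply, smul_eq_mul, RingHom.id_apply]
          rw [← integral_const_mul]
          simp [mul_left_comm]
        · simp [hz] }

end

noncomputable section

open Filter Topology

/-! Everything rests on `re_rho`: on the tube `Re ρ(z, w)` is a sum of nonnegative terms. Hence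
principal powers of `ρ` are holomorphic, and `|ρ(z, w)|` dominates `ρ(z)`, `ρ(w)` and `|z' - w'|²`.

Containment: a shear turns the tube into `ℂ^m` times a half-plane, where `|ρ(z, 𝐢)|^{-s}` is bounded
by a product of one-block powers, integrable for `s > n + α + 1` (`lintegral_norm_rho_rpow_lt_top`).

Density holds for every real exponent `t`, for `S_t ∩ A^p_α`. Given `f`, take the translate `f(z +
η𝐢)`, which has polynomial growth by the mean value inequality (`exists_norm_translate_le`), and
divide it by a high power of `1 + δ ρ(z, 𝐢)`. The limit `δ → 0` is dominated convergence. For `α <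
0` a single translation need not be bounded on `L^p(dV_α)`, but translations are bounded on average
over `η`, which suffices to pick a good `η` (`exists_eLpNorm_translate_sub_lt`).

Toeplitz operator: for fixed `z` the kernel is bounded in `w`, so a finite moment of order `s` puts
`S_s ∩ A^p_α` in the domain, which is therefore dense. Holomorphy is differentiation under the
integral: `∂ρ/ρ` is bounded locally in `z`, uniformly in `w`, so `K_α(z₀, w) f(w)` itself supplies
the dominating function. -/

/-! ### Geometry of the tube and lower bounds for `|ρ|` -/

theorem mem_tube_iff {m : ℕ} {z : Fin (m + 1) → ℂ} : z ∈ tube m ↔ 0 < rhoDiag z := by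
  simp [tube, tubeBase, rhoDiag]

@[fun_prop]
theorem continuous_rhoDiag {m : ℕ} : Continuous (rhoDiag (m := m)) := by
  unfold rhoDiag
  fun_prop

theorem isOpen_tube (m : ℕ) : IsOpen (tube m) := by
  have : tube m = rhoDiag ⁻¹' Set.Ioi 0 := by
    ext z
    exact mem_tube_iff
  rw [this]
  exact isOpen_Ioi.preimage continuous_rhoDiag

theorem measurableSet_tube (m : ℕ) : MeasurableSet (tube m) := (isOpen_tube m).measurableSet

@[fun_prop]
theorem continuous_rho_left {m : ℕ} (w : Fin (m + 1) → ℂ) : Continuous fun z => rho z w := by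
  unfold rho
  fun_prop

@[fun_prop]
theorem continuous_rho_right {m : ℕ} (z : Fin (m + 1) → ℂ) : Continuous fun w => rho z w := by
  have h : Continuous (starRingEnd ℂ) := Complex.continuous_conj
  unfold rho
  fun_prop

/-- Since `Re (a - b̄)² = |a - b|² - 2 (Im a)² - 2 (Im b)²`, the negative squares combine with the
last coordinates into `ρ(z)` and `ρ(w)`. -/
theorem re_rho {m : ℕ} (z w : Fin (m + 1) → ℂ) :
    (rho z w).re = (1 / 4) * (∑ k : Fin m, ‖z k.castSucc - w k.castSucc‖ ^ 2
      + 2 * rhoDiag z + 2 * rhoDiag w) := by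
  have h : ∀ k : Fin m, ((z k.castSucc - (starRingEnd ℂ) (w k.castSucc)) ^ 2).re =
      ‖z k.castSucc - w k.castSucc‖ ^ 2 - 2 * ((z k.castSucc).im) ^ 2
        - 2 * ((w k.castSucc).im) ^ 2 := by
    intro k
    rw [← Complex.normSq_eq_norm_sq, Complex.normSq_apply]
    simp [pow_two, Complex.mul_re]
    ring
  have h4 : (1 / 4 : ℂ) = ((1 / 4 : ℝ) : ℂ) := by push_cast; ring
  unfold rho
  rw [h4, Complex.re_ofReal_mul, Complex.sub_re, Complex.re_sum, Finset.sum_congr rfl fun k _ => h k]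
  simp [Finset.sum_sub_distrib, ← Finset.mul_sum, rhoDiag, Complex.mul_re]
  ring

theorem rhoDiag_basePt (m : ℕ) : rhoDiag (basePt m) = 1 := by
  simp [rhoDiag, basePt]

theorem basePt_mem_tube (m : ℕ) : basePt m ∈ tube m := by
  simp [mem_tube_iff, rhoDiag_basePt]

theorem rhoDiag_add_le_norm_rho {m : ℕ} (z w : Fin (m + 1) → ℂ) :
    rhoDiag z + rhoDiag w ≤ 2 * ‖rho z w‖ := by
  have h := Complex.re_le_norm (rho z w)
  rw [re_rho] at h
  have : 0 ≤ ∑ k : Fin m, ‖z k.castSucc - w k.castSucc‖ ^ 2 := by positivity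
  linarith

theorem norm_sub_sq_le {m : ℕ} {z w : Fin (m + 1) → ℂ} (hz : z ∈ tube m) (hw : w ∈ tube m)
    (k : Fin m) : ‖z k.castSucc - w k.castSucc‖ ^ 2 ≤ 4 * ‖rho z w‖ := by
  have h := Complex.re_le_norm (rho z w)
  rw [re_rho] at h
  rw [mem_tube_iff] at hz hw
  have := Finset.single_le_sum (f := fun k : Fin m => ‖z k.castSucc - w k.castSucc‖ ^ 2)
    (fun _ _ => by positivity) (Finset.mem_univ k)
  linarith

theorem re_rho_pos {m : ℕ} {z w : Fin (m + 1) → ℂ} (hz : z ∈ tube m) (hw : w ∈ tube m) :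
    0 < (rho z w).re := by
  rw [re_rho]
  rw [mem_tube_iff] at hz hw
  have : 0 ≤ ∑ k : Fin m, ‖z k.castSucc - w k.castSucc‖ ^ 2 := by positivity
  linarith

theorem norm_rho_pos {m : ℕ} {z w : Fin (m + 1) → ℂ} (hz : z ∈ tube m) (hw : w ∈ tube m) :
    0 < ‖rho z w‖ :=
  (re_rho_pos hz hw).trans_le (Complex.re_le_norm _)

theorem half_lt_norm_rho_basePt {m : ℕ} {z : Fin (m + 1) → ℂ} (hz : z ∈ tube m) :
    1 / 2 < ‖rho z (basePt m)‖ := by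
  have := rhoDiag_add_le_norm_rho z (basePt m)
  rw [rhoDiag_basePt] at this
  rw [mem_tube_iff] at hz
  linarith

/-- A power of `‖ρ(z, 𝐢)‖` is controlled by a larger power, as `‖ρ(z, 𝐢)‖ > 1/2` on the tube. -/
theorem norm_rho_basePt_rpow_le {m : ℕ} {z : Fin (m + 1) → ℂ} (hz : z ∈ tube m) {s t : ℝ}
    (hst : s ≤ t) :
    ‖rho z (basePt m)‖ ^ s ≤ 2 ^ (t - s) * ‖rho z (basePt m)‖ ^ t := by
  have h := half_lt_norm_rho_basePt hz
  have h0 := norm_rho_pos hz (basePt_mem_tube m)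
  have h1 : (1 : ℝ) ≤ (2 * ‖rho z (basePt m)‖) ^ (t - s) :=
    Real.one_le_rpow (by linarith) (by linarith)
  rw [Real.mul_rpow (by norm_num) h0.le] at h1
  calc _ ≤ (2 ^ (t - s) * ‖rho z (basePt m)‖ ^ (t - s)) * ‖rho z (basePt m)‖ ^ s :=
        le_mul_of_one_le_left (by positivity) h1
    _ = _ := by rw [mul_assoc, ← Real.rpow_add h0]; ring_nf

theorem differentiable_rho_left {m : ℕ} (w : Fin (m + 1) → ℂ) :
    Differentiable ℂ fun z => rho z w := by
  unfold rho
  fun_prop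

theorem continuousOn_bergmanKernel_right {m : ℕ} (α : ℝ) {z : Fin (m + 1) → ℂ} (hz : z ∈ tube m)
    (hΓ : 0 < α + 1) : ContinuousOn (fun w => bergmanKernel α z w) (tube m) := by
  unfold bergmanKernel
  have hg := Real.Gamma_pos_of_pos hΓ
  refine continuousOn_const.div (continuousOn_const.mul ?_) ?_
  · exact (continuous_rho_right z).continuousOn.cpow_const fun w hw => Or.inl (re_rho_pos hz hw)
  · intro w hw
    have := norm_pos_iff.1 (norm_rho_pos hz hw)
    refine mul_ne_zero ?_ ?_
    · exact_mod_cast (by positivity : (0 : ℝ) < 2 ^ (m + 2) * Real.pi ^ (m + 1) * Real.Gamma (α + 1)).ne'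
    · simp [Complex.cpow_eq_zero_iff, this]

/-! ### Integrability of powers of `|ρ(·, 𝐢)|` against `dV_α` -/

theorem lintegral_rpow_mul_one_add_rpow_lt_top {α b : ℝ} (hα : -1 < α) (hb : α + 1 < b) :
    ∫⁻ y in Set.Ioi (0 : ℝ), ENNReal.ofReal (y ^ α * (1 + y) ^ (-b)) < ⊤ := by
  have h1 : IntegrableOn (fun y : ℝ => y ^ α) (Set.Ioc 0 1) :=
    (intervalIntegrable_iff_integrableOn_Ioc_of_le zero_le_one).1
      (intervalIntegral.intervalIntegrable_rpow' hα)
  have h2 : IntegrableOn (fun y : ℝ => y ^ (α - b)) (Set.Ioi 1) :=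
    integrableOn_Ioi_rpow_of_lt (by linarith) zero_lt_one
  have hb0 : 0 < b := by linarith
  have hm : Measurable fun y : ℝ => y ^ α * (1 + y) ^ (-b) := by fun_prop
  have h : IntegrableOn (fun y : ℝ => y ^ α * (1 + y) ^ (-b)) (Set.Ioi 0) := by
    rw [← Set.Ioc_union_Ioi_eq_Ioi (zero_le_one : (0 : ℝ) ≤ 1)]
    refine IntegrableOn.union (h1.mono' hm.aestronglyMeasurable ?_)
      (h2.mono' hm.aestronglyMeasurable ?_)
    · refine (ae_restrict_iff' measurableSet_Ioc).2 (ae_of_all _ fun y hy => ?_)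
      have hy0 : 0 < y := hy.1
      rw [Real.norm_of_nonneg (by positivity)]
      exact mul_le_of_le_one_right (by positivity)
        (Real.rpow_le_one_of_one_le_of_nonpos (by linarith) (by linarith))
    · refine (ae_restrict_iff' measurableSet_Ioi).2 (ae_of_all _ fun y hy => ?_)
      have hy0 : 0 < y := zero_lt_one.trans hy
      rw [Real.norm_of_nonneg (by positivity), sub_eq_add_neg, Real.rpow_add hy0]
      gcongr ?_ * ?_
      exact Real.rpow_le_rpow_of_nonpos hy0 (by linarith) (by linarith)
  exact h.lintegral_lt_top

/-- Tonelli in the variables `(z', zₙ)`, with a shear in the last one. -/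
theorem lintegral_shear {m : ℕ} {H : (Fin m → ℂ) × ℂ → ENNReal} (hH : Measurable H)
    {σ : (Fin m → ℂ) → ℂ} (hσ : Measurable σ) :
    ∫⁻ z : Fin (m + 1) → ℂ, H (fun k => z k.castSucc, z (Fin.last m) - σ fun k => z k.castSucc) =
      ∫⁻ u, ∫⁻ ζ, H (u, ζ) := by
  have hF : Measurable fun q : ℂ × (Fin m → ℂ) => H (q.2, q.1 - σ q.2) := by fun_prop
  have h := (volume_preserving_piFinSuccAbove (fun _ : Fin (m + 1) => ℂ)
    (Fin.last m)).lintegral_comp hF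
  have e : ∀ z : Fin (m + 1) → ℂ,
      MeasurableEquiv.piFinSuccAbove (fun _ : Fin (m + 1) => ℂ) (Fin.last m) z =
        (z (Fin.last m), fun k => z k.castSucc) := by
    intro z
    ext k <;> simp [MeasurableEquiv.piFinSuccAbove, Fin.insertNthEquiv, Fin.init]
  simp only [e] at h
  rw [h, Measure.volume_eq_prod, lintegral_prod_symm _ hF.aemeasurable]
  exact lintegral_congr fun u => lintegral_sub_right_eq_self (fun ζ => H (u, ζ)) (σ u)

/-- The shear `x' · y' + i |y'|²` that maps the tube to `ℂ^m × {Im > 0}`. -/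
def tubeShear {m : ℕ} (u : Fin m → ℂ) : ℂ :=
  ⟨∑ k, (u k).re * (u k).im, ∑ k, (u k).im ^ 2⟩

theorem measurable_tubeShear {m : ℕ} : Measurable (tubeShear (m := m)) := by
  have : tubeShear (m := m) = fun u => ((∑ k, (u k).re * (u k).im : ℝ) : ℂ) +
      ((∑ k, (u k).im ^ 2 : ℝ) : ℂ) * Complex.I := by
    ext u
    exact Complex.mk_eq_add_mul_I _ _
  rw [this]
  have : Continuous fun u : Fin m → ℂ => ((∑ k, (u k).re * (u k).im : ℝ) : ℂ) +
      ((∑ k, (u k).im ^ 2 : ℝ) : ℂ) * Complex.I := by fun_prop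
  exact this.measurable

/-- The real part of the shear is chosen for this: `|ρ(z, 𝐢)|` then controls the sheared real
coordinate, the one direction not seen by `Re ρ`. -/
theorem im_rho_basePt {m : ℕ} (z : Fin (m + 1) → ℂ) :
    (rho z (basePt m)).im = -(z (Fin.last m) - tubeShear fun k => z k.castSucc).re / 2 := by
  have h4 : (1 / 4 : ℂ) = ((1 / 4 : ℝ) : ℂ) := by push_cast; ring
  unfold rho
  rw [h4, Complex.im_ofReal_mul, Complex.sub_im, Complex.im_sum]
  have h : ∀ k : Fin m, ((z k.castSucc - (starRingEnd ℂ) (basePt m k.castSucc)) ^ 2).im =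
      2 * ((z k.castSucc).re * (z k.castSucc).im) := by
    intro k
    simp [basePt, pow_two, Complex.mul_im]
    ring
  rw [Finset.sum_congr rfl fun k _ => h k, ← Finset.mul_sum]
  simp [tubeShear, basePt]
  ring

theorem norm_pi_sq_le {m : ℕ} (u : Fin m → ℂ) : ‖u‖ ^ 2 ≤ ∑ k, ‖u k‖ ^ 2 := by
  have hs : 0 ≤ ∑ k, ‖u k‖ ^ 2 := by positivity
  rw [← Real.le_sqrt (norm_nonneg _) hs, pi_norm_le_iff_of_nonneg (Real.sqrt_nonneg _)]
  intro k
  rw [Real.le_sqrt (norm_nonneg _) hs]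
  exact Finset.single_le_sum (f := fun k => ‖u k‖ ^ 2) (fun _ _ => by positivity)
    (Finset.mem_univ k)

/-- Anisotropic lower bound for `|ρ(z, 𝐢)|`. -/
theorem norm_rho_basePt_rpow_neg_le {m : ℕ} {z : Fin (m + 1) → ℂ} (hz : z ∈ tube m) {a b c : ℝ}
    (ha : 0 ≤ a) (hb : 0 ≤ b) (hc : 0 ≤ c) :
    ‖rho z (basePt m)‖ ^ (-(a + b + c)) ≤ 4 ^ (a + b + c) *
      ((1 + ‖fun k : Fin m => z k.castSucc‖ ^ 2) ^ (-a) * ((1 + rhoDiag z) ^ (-b) *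
        (1 + ‖(z (Fin.last m) - tubeShear fun k => z k.castSucc).re‖) ^ (-c))) := by
  set R := ‖rho z (basePt m)‖
  have hR : 0 < R := norm_rho_pos hz (basePt_mem_tube m)
  have hρ := mem_tube_iff.1 hz
  have hre := Complex.re_le_norm (rho z (basePt m))
  rw [re_rho, rhoDiag_basePt] at hre
  have hsum := norm_pi_sq_le fun k : Fin m => z k.castSucc
  have hb0 : ∀ k : Fin m, basePt m k.castSucc = 0 := fun k => by simp [basePt]
  simp only [hb0, sub_zero] at hre
  have him := Complex.abs_im_le_norm (rho z (basePt m))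
  rw [im_rho_basePt, abs_div, abs_neg, abs_two] at him
  have hsq : 0 ≤ ‖fun k : Fin m => z k.castSucc‖ ^ 2 := by positivity
  have hhalf := half_lt_norm_rho_basePt hz
  have h1 : (4 * R) ^ (-a) ≤ (1 + ‖fun k : Fin m => z k.castSucc‖ ^ 2) ^ (-a) :=
    Real.rpow_le_rpow_of_nonpos (by positivity) (by simp only [R]; linarith) (by linarith)
  have h2 : (4 * R) ^ (-b) ≤ (1 + rhoDiag z) ^ (-b) :=
    Real.rpow_le_rpow_of_nonpos (by positivity) (by simp only [R]; linarith) (by linarith)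
  have h3 : (4 * R) ^ (-c) ≤
      (1 + ‖(z (Fin.last m) - tubeShear fun k => z k.castSucc).re‖) ^ (-c) :=
    Real.rpow_le_rpow_of_nonpos (by positivity)
      (by rw [Real.norm_eq_abs]; simp only [R]; linarith) (by linarith)
  calc R ^ (-(a + b + c)) = 4 ^ (a + b + c) * (4 * R) ^ (-(a + b + c)) := by
        rw [Real.mul_rpow (by norm_num) hR.le, ← mul_assoc, ← Real.rpow_add (by norm_num)]
        simp
    _ = 4 ^ (a + b + c) * ((4 * R) ^ (-a) * ((4 * R) ^ (-b) * (4 * R) ^ (-c))) := by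
        rw [← Real.rpow_add (by positivity), ← Real.rpow_add (by positivity)]
        ring_nf
    _ ≤ _ := by gcongr

theorem measurable_weight {m : ℕ} (α : ℝ) :
    Measurable fun z : Fin (m + 1) → ℂ => ENNReal.ofReal (rhoDiag z ^ α) :=
  (continuous_rhoDiag.measurable.pow_const α).ennreal_ofReal

theorem lintegral_weightedVolume {m : ℕ} (α : ℝ) {g : (Fin (m + 1) → ℂ) → ENNReal}
    (hg : Measurable g) :
    ∫⁻ z, g z ∂weightedVolume m α =
      ∫⁻ z in tube m, ENNReal.ofReal (rhoDiag z ^ α) * g z := by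
  rw [weightedVolume, lintegral_withDensity_eq_lintegral_mul _ (measurable_weight α) hg]
  rfl

theorem ae_weightedVolume_mem {m : ℕ} (α : ℝ) : ∀ᵐ z ∂weightedVolume m α, z ∈ tube m :=
  (withDensity_absolutelyContinuous _ _).ae_le (ae_restrict_mem (measurableSet_tube m))

theorem lintegral_norm_rho_rpow_lt_top {m : ℕ} {α s : ℝ} (hα : -1 < α)
    (hs : (m + 1 : ℝ) + α + 1 < s) :
    ∫⁻ z, ENNReal.ofReal (‖rho z (basePt m)‖ ^ (-s)) ∂weightedVolume m α < ⊤ := by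
  -- The critical exponent is `m + (α + 1) + 1`, one summand for each of `z'`, `ρ(z)` and the real
  -- coordinate; the excess of `s` is shared equally.
  obtain ⟨d, hd, hds⟩ : ∃ d : ℝ, 0 < d ∧ s = (m + d) + (α + 1 + d) + (1 + d) :=
    ⟨(s - (m + 1 + α + 1)) / 3, by linarith, by ring⟩
  set a := (m : ℝ) + d
  set b := α + 1 + d
  set c := 1 + d
  have hm0 : (0 : ℝ) ≤ m := Nat.cast_nonneg m
  have ha0 : 0 ≤ a := by positivity
  have hb0 : 0 ≤ b := by simp only [b]; linarith
  have hc0 : 0 ≤ c := by positivity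
  let A : (Fin m → ℂ) → ENNReal := fun u => ENNReal.ofReal ((1 + ‖u‖ ^ 2) ^ (-a))
  let B : ℝ → ENNReal := (Set.Ioi (0 : ℝ)).indicator fun y =>
    ENNReal.ofReal (y ^ α * (1 + y) ^ (-b))
  let C : ℝ → ENNReal := fun x => ENNReal.ofReal ((1 + ‖x‖) ^ (-c))
  have hA : Measurable A := by fun_prop
  have hB : Measurable B := Measurable.indicator (by fun_prop) measurableSet_Ioi
  have hC : Measurable C := by fun_prop
  have hAfin : ∫⁻ u, A u < ⊤ := by
    have hdim : Module.finrank ℝ (Fin m → ℂ) = 2 * m := by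
      simp [Module.finrank_pi_fintype, Complex.finrank_real_complex, mul_comm]
    -- The exponent there is `-r / 2`, so `r = 2a` must exceed the real dimension `2m`.
    have := (integrable_rpow_neg_one_add_norm_sq (E := Fin m → ℂ) (μ := volume) (r := 2 * a)
      (by rw [hdim]; push_cast; simp only [a]; linarith)).lintegral_lt_top
    convert this using 5
    ring_nf
  have hBfin : ∫⁻ y, B y < ⊤ := by
    rw [lintegral_indicator measurableSet_Ioi]
    exact lintegral_rpow_mul_one_add_rpow_lt_top hα (by simp only [b]; linarith)
  have hCfin : ∫⁻ x, C x < ⊤ :=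
    (integrable_one_add_norm (E := ℝ) (μ := volume) (r := c)
      (by simp [c]; linarith)).lintegral_lt_top
  let H : (Fin m → ℂ) × ℂ → ENNReal := fun q => A q.1 * (C q.2.re * B q.2.im)
  have hH : Measurable H := by
    have h1 := hC.comp Complex.measurable_re
    have h2 := hB.comp Complex.measurable_im
    exact (hA.comp measurable_fst).mul ((h1.mul h2).comp measurable_snd)
  have hHfin : ∫⁻ u, ∫⁻ ζ, H (u, ζ) < ⊤ := by
    have h1 : ∫⁻ ζ : ℂ, C ζ.re * B ζ.im = (∫⁻ x, C x) * ∫⁻ y, B y := by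
      have := Complex.volume_preserving_equiv_real_prod.lintegral_comp
        (f := fun q : ℝ × ℝ => C q.1 * B q.2) (by fun_prop)
      rw [← lintegral_prod_mul hC.aemeasurable hB.aemeasurable, ← Measure.volume_eq_prod, ← this]
      rfl
    have h2 : ∀ u, ∫⁻ ζ, H (u, ζ) = A u * ((∫⁻ x, C x) * ∫⁻ y, B y) := fun u => by
      rw [← h1, ← lintegral_const_mul]
      exact (hC.comp Complex.measurable_re).mul (hB.comp Complex.measurable_im)
    simp_rw [h2]
    rw [lintegral_mul_const _ hA]
    exact ENNReal.mul_lt_top hAfin (ENNReal.mul_lt_top hCfin hBfin)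
  rw [lintegral_weightedVolume]
  · rw [← lintegral_shear hH measurable_tubeShear] at hHfin
    refine lt_of_le_of_lt (setLIntegral_mono_ae (g := fun z : Fin (m + 1) → ℂ =>
      ENNReal.ofReal (4 ^ s) * H (fun k => z k.castSucc, z (Fin.last m) -
        tubeShear fun k => z k.castSucc)) ?_ (ae_of_all _ fun z hz => ?_)) ?_
    · have h1 : Measurable fun z : Fin (m + 1) → ℂ => (fun k : Fin m => z k.castSucc) := by fun_prop
      have h2 := measurable_tubeShear.comp h1
      have h3 := hH.comp (h1.prodMk ((measurable_pi_apply (Fin.last m)).sub h2))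
      exact (h3.const_mul _).aemeasurable
    · have hρ := mem_tube_iff.1 hz
      have him : (z (Fin.last m) - tubeShear fun k => z k.castSucc).im = rhoDiag z := by
        simp [tubeShear, rhoDiag]
      have hk := norm_rho_basePt_rpow_neg_le hz ha0 hb0 hc0
      rw [← hds] at hk
      simp only [H, A, B, C, him, Set.indicator_of_mem (Set.mem_Ioi.2 hρ)]
      rw [← ENNReal.ofReal_mul (by positivity), ← ENNReal.ofReal_mul (by positivity),
        ← ENNReal.ofReal_mul (by positivity), ← ENNReal.ofReal_mul (by positivity)]
      refine ENNReal.ofReal_le_ofReal ((mul_le_mul_of_nonneg_left hk (by positivity)).trans_eq ?_)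
      ring
    · rw [lintegral_const_mul']
      · exact ENNReal.mul_lt_top ENNReal.ofReal_lt_top ((setLIntegral_le_lintegral _ _).trans_lt hHfin)
      · exact ENNReal.ofReal_ne_top
  · have := (continuous_rho_left (basePt m)).measurable
    fun_prop

/-! ### `S_t` inside `A^p_α`, and local finiteness of `dV_α` -/

theorem DifferentiableOn.aestronglyMeasurable_weightedVolume {m : ℕ} {f : (Fin (m + 1) → ℂ) → ℂ}
    (hf : DifferentiableOn ℂ f (tube m)) (α : ℝ) : AEStronglyMeasurable f (weightedVolume m α) :=
  (hf.continuousOn.aestronglyMeasurable (measurableSet_tube m)).mono_ac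
    (withDensity_absolutelyContinuous _ _)

theorem decaySpace_le_bergmanSpace {m : ℕ} {p α t : ℝ} (hp : 1 ≤ p) (hα : -1 < α)
    (ht : (m + 1 : ℝ) + (α + 1) / p < t) : decaySpace m t ≤ bergmanSpace m p α := by
  rintro f ⟨hf, C, hC⟩
  have hp0 : 0 < p := by linarith
  refine ⟨hf, hf.aestronglyMeasurable_weightedVolume α, ?_⟩
  rw [eLpNorm_lt_top_iff_lintegral_rpow_enorm_lt_top (by simpa using hp0) ENNReal.ofReal_ne_top,
    ENNReal.toReal_ofReal hp0.le]
  -- Indeed `tp > np + α + 1 ≥ n + α + 1`, as `p ≥ 1`.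
  have hs : (m + 1 : ℝ) + α + 1 < t * p := by
    have h := mul_lt_mul_of_pos_right ht hp0
    rw [add_mul, div_mul_cancel₀ _ hp0.ne'] at h
    nlinarith [(Nat.cast_nonneg m : (0 : ℝ) ≤ m)]
  have hC0 : 0 ≤ C := le_trans (by positivity) (hC _ (basePt_mem_tube m))
  refine lt_of_le_of_lt (lintegral_mono_ae (g := fun z => ENNReal.ofReal (C ^ p) *
    ENNReal.ofReal (‖rho z (basePt m)‖ ^ (-(t * p)))) ?_) ?_
  · filter_upwards [ae_weightedVolume_mem α] with z hz
    have hR := norm_rho_pos hz (basePt_mem_tube m)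
    rw [← ofReal_norm, ENNReal.ofReal_rpow_of_nonneg (norm_nonneg _) hp0.le,
      ← ENNReal.ofReal_mul (by positivity)]
    refine ENNReal.ofReal_le_ofReal ?_
    have h1 : ‖f z‖ ≤ C * ‖rho z (basePt m)‖ ^ (-t) := by
      rw [Real.rpow_neg hR.le, ← div_eq_mul_inv, le_div_iff₀ (by positivity), mul_comm]
      exact hC z hz
    calc ‖f z‖ ^ p ≤ (C * ‖rho z (basePt m)‖ ^ (-t)) ^ p := by gcongr
      _ = _ := by rw [Real.mul_rpow hC0 (by positivity), ← Real.rpow_mul hR.le, neg_mul]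
  · rw [lintegral_const_mul' _ _ ENNReal.ofReal_ne_top]
    exact ENNReal.mul_lt_top ENNReal.ofReal_lt_top (lintegral_norm_rho_rpow_lt_top hα hs)

/-- Only boundary points are in doubt, where the weight may blow up. Chebyshev's inequality for the
integrable power of `|ρ(·, 𝐢)|` bounds the mass of its sublevel sets. -/
theorem isLocallyFiniteMeasure_weightedVolume {m : ℕ} {α : ℝ} (hα : -1 < α) :
    IsLocallyFiniteMeasure (weightedVolume m α) := by
  refine ⟨fun x => ?_⟩
  set s : ℝ := (m + 1 : ℝ) + α + 2
  have hs0 : 0 < s := by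
    have := (Nat.cast_nonneg m : (0 : ℝ) ≤ m)
    simp only [s]; linarith
  have hfin := lintegral_norm_rho_rpow_lt_top (m := m) (s := s) hα (by simp only [s]; linarith)
  set M := ‖rho x (basePt m)‖ + 1
  have hM0 : 0 < M := by positivity
  have hcont := (continuous_rho_left (basePt m)).norm
  have hopen : IsOpen {z | ‖rho z (basePt m)‖ < M} := isOpen_lt hcont continuous_const
  refine ⟨_, hopen.mem_nhds (show ‖rho x (basePt m)‖ < M by simp [M]), ?_⟩
  have key : ENNReal.ofReal (M ^ (-s)) * weightedVolume m α {z | ‖rho z (basePt m)‖ < M} ≤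
      ∫⁻ z, ENNReal.ofReal (‖rho z (basePt m)‖ ^ (-s)) ∂weightedVolume m α := by
    rw [← setLIntegral_const]
    refine (lintegral_mono_ae ?_).trans (setLIntegral_le_lintegral {z | ‖rho z (basePt m)‖ < M} _)
    filter_upwards [ae_restrict_mem hopen.measurableSet, ae_restrict_of_ae (ae_weightedVolume_mem α)]
      with z hz hzt
    exact ENNReal.ofReal_le_ofReal (Real.rpow_le_rpow_of_nonpos
      (norm_rho_pos hzt (basePt_mem_tube m)) (le_of_lt hz) (by linarith))
  by_contra h
  rw [not_lt, top_le_iff] at h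
  rw [h, ENNReal.mul_top (by simpa using by positivity)] at key
  exact absurd (key.trans_lt hfin) (lt_irrefl _)

/-! ### The logarithmic derivative of `ρ(·, w)`, uniformly in `w` -/

/-- The complex differential of `z ↦ ρ(z, w)`. -/
def rhoDeriv {m : ℕ} (z w : Fin (m + 1) → ℂ) : (Fin (m + 1) → ℂ) →L[ℂ] ℂ :=
  (1 / 2 : ℂ) • (∑ k : Fin m, (z k.castSucc - (starRingEnd ℂ) (w k.castSucc)) •
    ContinuousLinearMap.proj (R := ℂ) (φ := fun _ : Fin (m + 1) => ℂ) k.castSucc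
    - Complex.I • ContinuousLinearMap.proj (R := ℂ) (φ := fun _ : Fin (m + 1) => ℂ) (Fin.last m))

theorem hasFDerivAt_rho {m : ℕ} (z w : Fin (m + 1) → ℂ) :
    HasFDerivAt (fun z => rho z w) (rhoDeriv z w) z := by
  have hp : ∀ k : Fin (m + 1), HasFDerivAt (fun z : Fin (m + 1) → ℂ => z k)
      (ContinuousLinearMap.proj (R := ℂ) (φ := fun _ : Fin (m + 1) => ℂ) k) z := fun k =>
    (ContinuousLinearMap.proj (R := ℂ) (φ := fun _ : Fin (m + 1) => ℂ) k).hasFDerivAt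
  have h1 := HasFDerivAt.fun_sum (u := Finset.univ) fun (k : Fin m) _ =>
    ((hp k.castSucc).sub_const ((starRingEnd ℂ) (w k.castSucc))).pow 2
  have h2 := ((hp (Fin.last m)).sub_const ((starRingEnd ℂ) (w (Fin.last m)))).const_mul
    (2 * Complex.I)
  refine ((h1.sub h2).const_mul (1 / 4 : ℂ)).congr_fderiv ?_
  ext v
  simp [rhoDeriv, mul_sub, Finset.mul_sum]
  congr 1
  · exact Finset.sum_congr rfl fun k _ => by ring
  · ring

theorem norm_rhoDeriv_le {m : ℕ} (z w : Fin (m + 1) → ℂ) :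
    ‖rhoDeriv z w‖ ≤ ∑ k : Fin m, ‖z k.castSucc - (starRingEnd ℂ) (w k.castSucc)‖ + 1 := by
  refine ContinuousLinearMap.opNorm_le_bound _ (by positivity) fun v => ?_
  simp only [rhoDeriv, smul_apply, sub_apply, sum_apply, ContinuousLinearMap.proj_apply, smul_eq_mul, norm_mul]
  have h1 : ‖∑ k : Fin m, (z k.castSucc - (starRingEnd ℂ) (w k.castSucc)) * v k.castSucc‖ ≤
      (∑ k : Fin m, ‖z k.castSucc - (starRingEnd ℂ) (w k.castSucc)‖) * ‖v‖ := by
    rw [Finset.sum_mul]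
    refine norm_sum_le_of_le _ fun k _ => ?_
    rw [norm_mul]
    gcongr
    exact norm_le_pi_norm v _
  have h2 : ‖Complex.I * v (Fin.last m)‖ ≤ ‖v‖ := by
    rw [norm_mul, Complex.norm_I, one_mul]
    exact norm_le_pi_norm v _
  have h3 := norm_sub_le (∑ k : Fin m, (z k.castSucc - (starRingEnd ℂ) (w k.castSucc)) *
    v k.castSucc) (Complex.I * v (Fin.last m))
  have h4 : ‖(1 / 2 : ℂ)‖ = 1 / 2 := by norm_num
  rw [h4]
  have h5 := norm_nonneg (∑ k : Fin m, (z k.castSucc - (starRingEnd ℂ) (w k.castSucc)) *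
    v k.castSucc - Complex.I * v (Fin.last m))
  rw [add_mul]
  linarith

/-- Conjugation moves `b` by `2 |Im b| ≤ 2 |Im a| + 2 |a - b|`, and `|a - b|² ≤ 4 |ρ|` absorbs the
unbounded part. -/
theorem norm_sub_conj_le {m : ℕ} {z w : Fin (m + 1) → ℂ} (hz : z ∈ tube m) (hw : w ∈ tube m)
    (k : Fin m) : ‖z k.castSucc - (starRingEnd ℂ) (w k.castSucc)‖ ≤
      3 + 2 * ‖z‖ + 12 * ‖rho z w‖ := by
  have hd := norm_sub_sq_le hz hw k
  set a := z k.castSucc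
  set b := w k.castSucc
  have h1 : b - (starRingEnd ℂ) b = ((2 * b.im : ℝ) : ℂ) * Complex.I := Complex.sub_conj b
  have h2 : ‖b - (starRingEnd ℂ) b‖ = 2 * |b.im| := by simp [h1]
  have h3 : |b.im| ≤ |a.im| + ‖a - b‖ := by
    have := Complex.abs_im_le_norm (a - b)
    rw [Complex.sub_im, abs_sub_comm] at this
    have := abs_sub_abs_le_abs_sub b.im a.im
    linarith
  have h4 : |a.im| ≤ ‖z‖ := (Complex.abs_im_le_norm a).trans (norm_le_pi_norm z _)
  have h5 : ‖a - (starRingEnd ℂ) b‖ ≤ ‖a - b‖ + ‖b - (starRingEnd ℂ) b‖ :=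
    norm_sub_le_norm_sub_add_norm_sub _ _ _
  nlinarith [sq_nonneg (‖a - b‖ - 1)]

/-- `|∂ρ(z, w)| ≤ A(z) |ρ(z, w)|` with `A` continuous on the tube. -/
theorem norm_rhoDeriv_le_mul {m : ℕ} {z w : Fin (m + 1) → ℂ} (hz : z ∈ tube m) (hw : w ∈ tube m) :
    ‖rhoDeriv z w‖ ≤ ((m * (3 + 2 * ‖z‖) + 1) * (2 / rhoDiag z) + 12 * m) * ‖rho z w‖ := by
  have h1 := norm_rhoDeriv_le z w
  have h2 : ∑ k : Fin m, ‖z k.castSucc - (starRingEnd ℂ) (w k.castSucc)‖ ≤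
      m * (3 + 2 * ‖z‖ + 12 * ‖rho z w‖) :=
    (Finset.sum_le_card_nsmul _ _ _ fun k _ => norm_sub_conj_le hz hw k).trans_eq
      (by rw [Finset.card_univ, Fintype.card_fin, nsmul_eq_mul])
  have hρz := mem_tube_iff.1 hz
  have hρw := mem_tube_iff.1 hw
  -- This converts additive constants into multiples of `|ρ(z, w)|`.
  have h3 : 1 ≤ 2 / rhoDiag z * ‖rho z w‖ := by
    rw [div_mul_eq_mul_div, one_le_div hρz]
    linarith [rhoDiag_add_le_norm_rho z w]
  have h4 : 0 ≤ (m : ℝ) * (3 + 2 * ‖z‖) + 1 := by positivity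
  nlinarith [mul_le_mul_of_nonneg_left h3 h4]

/-- Locally uniform control of `ρ(·, w)` and its derivative, uniformly in `w`. -/
theorem exists_ball_rhoDeriv_le {m : ℕ} {z₀ : Fin (m + 1) → ℂ} (hz₀ : z₀ ∈ tube m) :
    ∃ r > 0, ∃ A > 0, Metric.ball z₀ r ⊆ tube m ∧ ∀ z ∈ Metric.ball z₀ r, ∀ w ∈ tube m,
      ‖rhoDeriv z w‖ ≤ A * ‖rho z w‖ ∧ ‖rho z₀ w‖ ≤ A * ‖rho z w‖ := by
  set g : (Fin (m + 1) → ℂ) → ℝ := fun z =>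
    (m * (3 + 2 * ‖z‖) + 1) * (2 / rhoDiag z) + 12 * m
  have hg : ContinuousAt g z₀ := by
    have : rhoDiag z₀ ≠ 0 := (mem_tube_iff.1 hz₀).ne'
    have h : ContinuousAt rhoDiag z₀ := continuous_rhoDiag.continuousAt
    fun_prop (disch := assumption)
  have hev := (hg.eventually_lt_const (lt_add_one (g z₀))).and ((isOpen_tube m).mem_nhds hz₀)
  obtain ⟨r, hr, hball⟩ := Metric.eventually_nhds_iff_ball.1 hev
  have hg0 : 0 ≤ g z₀ := by
    have := mem_tube_iff.1 hz₀
    positivity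
  set B := g z₀ + 1
  have hB : 0 < B := by positivity
  have hderiv : ∀ z ∈ Metric.ball z₀ r, ∀ w ∈ tube m, ‖rhoDeriv z w‖ ≤ B * ‖rho z w‖ :=
    fun z hz w hw => (norm_rhoDeriv_le_mul (hball z hz).2 hw).trans
      (mul_le_mul_of_nonneg_right (hball z hz).1.le (norm_nonneg _))
  refine ⟨r, hr, max B (Real.exp (B * r)), lt_max_of_lt_left hB, fun z hz => (hball z hz).2,
    fun z hz w hw => ⟨(hderiv z hz w hw).trans ?_, ?_⟩⟩
  · gcongr
    exact le_max_left _ _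
  -- A bounded logarithmic derivative makes `log ρ(·, w)` Lipschitz on the ball; its real part gives
  -- the comparison with constant `exp (B r)`.
  · have hlog : ‖Complex.log (rho z₀ w) - Complex.log (rho z w)‖ ≤ B * ‖z₀ - z‖ := by
      refine (convex_ball z₀ r).norm_image_sub_le_of_norm_hasFDerivWithin_le (𝕜 := ℂ)
        (f := fun x => Complex.log (rho x w)) (f' := fun x => (rho x w)⁻¹ • rhoDeriv x w)
        (fun x hx => ?_) (fun x hx => ?_) hz (Metric.mem_ball_self hr)
      · exact ((hasFDerivAt_rho x w).clog
          (Or.inl (re_rho_pos (hball x hx).2 hw))).hasFDerivWithinAt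
      · rw [norm_smul, norm_inv, inv_mul_le_iff₀ (norm_rho_pos (hball x hx).2 hw), mul_comm]
        exact hderiv x hx w hw
    have hpos := norm_rho_pos (hball z hz).2 hw
    have hpos0 := norm_rho_pos hz₀ hw
    have h1 : Real.log ‖rho z₀ w‖ - Real.log ‖rho z w‖ ≤ B * r := by
      have h2 := Complex.re_le_norm (Complex.log (rho z₀ w) - Complex.log (rho z w))
      rw [Complex.sub_re, Complex.log_re, Complex.log_re] at h2
      have h3 : ‖z₀ - z‖ ≤ r := by
        rw [← dist_eq_norm, dist_comm]
        exact (Metric.mem_ball.1 hz).le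
      have := mul_le_mul_of_nonneg_left h3 hB.le
      linarith
    calc ‖rho z₀ w‖ = Real.exp (Real.log ‖rho z₀ w‖) := (Real.exp_log hpos0).symm
      _ ≤ Real.exp (B * r + Real.log ‖rho z w‖) := Real.exp_le_exp.2 (by linarith)
      _ = Real.exp (B * r) * ‖rho z w‖ := by rw [Real.exp_add, Real.exp_log hpos]
      _ ≤ _ := by gcongr; exact le_max_right _ _

/-! ### The Toeplitz operator: domain and holomorphy -/

/-- The constant factor of the Bergman kernel. -/
def kernelConst (m : ℕ) (α : ℝ) : ℂ :=
  ((Real.Gamma ((m + 1 : ℝ) + α + 1) : ℝ) : ℂ) /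
    (((2 : ℝ) ^ (m + 2) * Real.pi ^ (m + 1) * Real.Gamma (α + 1) : ℝ) : ℂ)

theorem bergmanKernel_eq {m : ℕ} (α : ℝ) (z w : Fin (m + 1) → ℂ) :
    bergmanKernel α z w =
      kernelConst m α * rho z w ^ (((-((m + 1 : ℝ) + α + 1) : ℝ)) : ℂ) := by
  rw [bergmanKernel, kernelConst, Complex.ofReal_neg, Complex.cpow_neg, ← div_div, div_eq_mul_inv]

theorem norm_bergmanKernel {m : ℕ} (α : ℝ) (z w : Fin (m + 1) → ℂ) :
    ‖bergmanKernel α z w‖ = ‖kernelConst m α‖ * ‖rho z w‖ ^ (-((m + 1 : ℝ) + α + 1)) := by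
  rw [bergmanKernel_eq, norm_mul, Complex.norm_cpow_real]

/-- For fixed `z`, `|ρ(z, w)| ≥ ρ(z) / 2` bounds the kernel uniformly in `w`, so the decay of `f`
and the moment of `μ` suffice. -/
theorem submoduleOf_le_toeplitz_domain {m : ℕ} {p α t : ℝ} (hα : -1 < α)
    {μ : Measure (Fin (m + 1) → ℂ)} (hμ : FiniteMoment μ t) :
    (decaySpace m t).submoduleOf (bergmanSpace m p α) ≤ (toeplitz p α μ).domain := by
  intro f hf z hz
  obtain ⟨hd, C, hC⟩ := Submodule.mem_comap.1 hf
  have hC0 : 0 ≤ C := le_trans (by positivity) (hC _ (basePt_mem_tube m))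
  set a : ℝ := (m + 1 : ℝ) + α + 1
  have ha : 0 ≤ a := by
    have := (Nat.cast_nonneg m : (0 : ℝ) ≤ m)
    simp only [a]; linarith
  have hmeas := (continuousOn_bergmanKernel_right α hz (by linarith)).mul hd.continuousOn
  refine ⟨hmeas.aestronglyMeasurable (measurableSet_tube m), ?_⟩
  set D := ‖kernelConst m α‖ * (rhoDiag z / 2) ^ (-a) * C
  refine lt_of_le_of_lt (setLIntegral_mono_ae' (g := fun w => ENNReal.ofReal D *
    ENNReal.ofReal (1 / ‖rho w (basePt m)‖ ^ t)) (measurableSet_tube m)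
    (ae_of_all _ fun w hw => ?_)) ?_
  · have hρ := mem_tube_iff.1 hz
    have hR := norm_rho_pos hw (basePt_mem_tube m)
    have h1 : rhoDiag z / 2 ≤ ‖rho z w‖ := by
      linarith [rhoDiag_add_le_norm_rho z w, mem_tube_iff.1 hw]
    have h2 : ‖f.1 w‖ ≤ C * (1 / ‖rho w (basePt m)‖ ^ t) := by
      rw [mul_one_div, le_div_iff₀ (by positivity), mul_comm]
      exact hC w hw
    have h3 : ‖rho z w‖ ^ (-a) ≤ (rhoDiag z / 2) ^ (-a) :=
      Real.rpow_le_rpow_of_nonpos (by positivity) h1 (by linarith)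
    rw [← ofReal_norm, ← ENNReal.ofReal_mul (by positivity), norm_mul, norm_bergmanKernel]
    refine ENNReal.ofReal_le_ofReal ?_
    calc _ ≤ ‖kernelConst m α‖ * (rhoDiag z / 2) ^ (-a) * (C * (1 / ‖rho w (basePt m)‖ ^ t)) := by
          gcongr
      _ = _ := by ring
  · rw [lintegral_const_mul' _ _ ENNReal.ofReal_ne_top]
    exact ENNReal.mul_lt_top ENNReal.ofReal_lt_top hμ

theorem FiniteMoment.mono {m : ℕ} {μ : Measure (Fin (m + 1) → ℂ)} {s t : ℝ}
    (h : FiniteMoment μ s) (hst : s ≤ t) : FiniteMoment μ t := by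
  refine lt_of_le_of_lt (setLIntegral_mono_ae' (g := fun w => ENNReal.ofReal (2 ^ (t - s)) *
    ENNReal.ofReal (1 / ‖rho w (basePt m)‖ ^ s)) (measurableSet_tube m)
    (ae_of_all _ fun w hw => ?_)) ?_
  · have hR := norm_rho_pos hw (basePt_mem_tube m)
    rw [← ENNReal.ofReal_mul (by positivity)]
    refine ENNReal.ofReal_le_ofReal ?_
    rw [mul_one_div, div_le_div_iff₀ (by positivity) (by positivity), one_mul]
    exact norm_rho_basePt_rpow_le hw hst
  · rw [lintegral_const_mul' _ _ ENNReal.ofReal_ne_top]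
    exact ENNReal.mul_lt_top ENNReal.ofReal_lt_top h

theorem differentiableOn_toeplitz {m : ℕ} {p α : ℝ} (hα : -1 < α)
    {μ : Measure (Fin (m + 1) → ℂ)} (f : (toeplitz p α μ).domain) :
    DifferentiableOn ℂ (toeplitz p α μ f) (tube m) := by
  obtain ⟨⟨f, hfd, hfp⟩, hfi⟩ := f
  replace hfi : ∀ z ∈ tube m,
    Integrable (fun w => bergmanKernel α z w * f w) (μ.restrict (tube m)) := hfi
  suffices h : DifferentiableOn ℂ (fun z => ∫ w in tube m, bergmanKernel α z w * f w ∂μ)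
      (tube m) from h.congr fun z hz => Set.indicator_of_mem hz
      (fun z => ∫ w in tube m, bergmanKernel α z w * f w ∂μ)
  intro z₀ hz₀
  obtain ⟨r, hr, A, hA, hball, hbound⟩ := exists_ball_rhoDeriv_le hz₀
  set a : ℝ := (m + 1 : ℝ) + α + 1
  have ha : 0 < a := by
    have := (Nat.cast_nonneg m : (0 : ℝ) ≤ m)
    simp only [a]; linarith
  let F' : (Fin (m + 1) → ℂ) → (Fin (m + 1) → ℂ) → ((Fin (m + 1) → ℂ) →L[ℂ] ℂ) := fun z w =>
    (f w * kernelConst m α * (((-a : ℝ) : ℂ) * rho z w ^ (((-a : ℝ) : ℂ) - 1))) • rhoDeriv z w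
  have hderiv : HasFDerivAt (fun z => ∫ w in tube m, bergmanKernel α z w * f w ∂μ)
      (∫ w in tube m, F' z₀ w ∂μ) z₀ := by
    -- In the bound, `a` comes from the power rule, `A` from `∂ρ`, and `A ^ a` from replacing `|ρ(z,
    -- w)|^{-a}` by `|ρ(z₀, w)|^{-a}`.
    refine hasFDerivAt_integral_of_dominated_of_fderiv_le (s := Metric.ball z₀ r)
      (bound := fun w => a * A * A ^ a * ‖bergmanKernel α z₀ w * f w‖)
      (Metric.ball_mem_nhds z₀ hr) ?_ (hfi z₀ hz₀) ?_ ?_ ((hfi z₀ hz₀).norm.const_mul _) ?_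
    · filter_upwards [(isOpen_tube m).mem_nhds hz₀] with z hz
      exact (hfi z hz).1
    · refine ContinuousOn.aestronglyMeasurable ?_ (measurableSet_tube m)
      refine ContinuousOn.fun_smul ?_ ?_
      · refine (hfd.continuousOn.mul continuousOn_const).mul (continuousOn_const.mul ?_)
        exact (continuous_rho_right z₀).continuousOn.cpow_const
          fun w hw => Or.inl (re_rho_pos hz₀ hw)
      · have h : Continuous (starRingEnd ℂ) := Complex.continuous_conj
        unfold rhoDeriv
        fun_prop
    · refine (ae_restrict_iff' (measurableSet_tube m)).2 (ae_of_all _ fun w hw z hz => ?_)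
      obtain ⟨h1, h2⟩ := hbound z hz w hw
      have hR := norm_rho_pos (hball hz) hw
      have hR0 := norm_rho_pos hz₀ hw
      have h3 : ‖rho z w‖ ^ (-a) ≤ A ^ a * ‖rho z₀ w‖ ^ (-a) := by
        rw [Real.rpow_neg hR.le, Real.rpow_neg hR0.le, ← div_eq_mul_inv, le_div_iff₀ (by positivity),
          inv_mul_le_iff₀ (by positivity), mul_comm, ← Real.mul_rpow hA.le hR.le]
        exact Real.rpow_le_rpow hR0.le h2 ha.le
      have h4 : ‖rho z w ^ (((-a : ℝ) : ℂ) - 1)‖ = ‖rho z w‖ ^ (-a) * ‖rho z w‖⁻¹ := by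
        rw [Complex.cpow_sub _ _ (norm_pos_iff.1 hR), Complex.cpow_one, norm_div,
          Complex.norm_cpow_real, div_eq_mul_inv]
      simp only [F']
      rw [norm_smul, norm_mul, norm_mul, norm_mul, h4, Complex.norm_real, norm_neg,
        Real.norm_of_nonneg ha.le, norm_mul,
        show ‖bergmanKernel α z₀ w‖ = ‖kernelConst m α‖ * ‖rho z₀ w‖ ^ (-a) from
          norm_bergmanKernel α z₀ w]
      calc ‖f w‖ * ‖kernelConst m α‖ * (a * (‖rho z w‖ ^ (-a) * ‖rho z w‖⁻¹)) * ‖rhoDeriv z w‖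
          ≤ ‖f w‖ * ‖kernelConst m α‖ * (a * ((A ^ a * ‖rho z₀ w‖ ^ (-a)) * ‖rho z w‖⁻¹)) *
            (A * ‖rho z w‖) := by gcongr
        _ = _ := by field_simp
    · refine (ae_restrict_iff' (measurableSet_tube m)).2 (ae_of_all _ fun w hw z hz => ?_)
      have h := ((((hasDerivAt_id (rho z w)).cpow_const (c := ((-a : ℝ) : ℂ))
        (Or.inl (re_rho_pos (hball hz) hw))).comp_hasFDerivAt z (hasFDerivAt_rho z w)).const_mul
        (kernelConst m α)).mul_const (f w)
      refine (h.congr_of_eventuallyEq (Eventually.of_forall fun x => ?_)).congr_fderiv ?_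
      · exact congrArg (· * f w) (bergmanKernel_eq α x w)
      · simp only [F', smul_smul, id]
        congr 1
        ring
  exact hderiv.differentiableAt.differentiableWithinAt

/-! ### Vertical translations in `L^p(dV_α)` -/

/-- The weight `x ↦ x^α`, extended by zero to `x ≤ 0`. -/
def powWeight (α : ℝ) : ℝ → ENNReal :=
  (Set.Ioi (0 : ℝ)).indicator fun x => ENNReal.ofReal (x ^ α)

@[fun_prop]
theorem measurable_powWeight (α : ℝ) : Measurable (powWeight α) :=
  Measurable.indicator (by fun_prop) measurableSet_Ioi

theorem powWeight_of_pos {α x : ℝ} (hx : 0 < x) : powWeight α x = ENNReal.ofReal (x ^ α) :=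
  Set.indicator_of_mem (Set.mem_Ioi.2 hx) _

theorem powWeight_of_nonpos {α x : ℝ} (hx : x ≤ 0) : powWeight α x = 0 :=
  Set.indicator_of_notMem (by simpa using hx) _

theorem lintegral_weightedVolume_eq_powWeight {m : ℕ} (α : ℝ) {g : (Fin (m + 1) → ℂ) → ENNReal}
    (hg : Measurable g) :
    ∫⁻ z, g z ∂weightedVolume m α = ∫⁻ z, powWeight α (rhoDiag z) * g z := by
  rw [lintegral_weightedVolume α hg, ← lintegral_indicator (measurableSet_tube m)]
  refine lintegral_congr fun z => ?_
  by_cases hz : z ∈ tube m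
  · rw [Set.indicator_of_mem hz, powWeight_of_pos (mem_tube_iff.1 hz)]
  · rw [Set.indicator_of_notMem hz,
      powWeight_of_nonpos (not_lt.1 fun h => hz (mem_tube_iff.2 h)), zero_mul]

/-- The weight `x^α` has integrable singularity, so its averages over translates are comparable to
it. -/
theorem lintegral_powWeight_sub_le {α ε : ℝ} (hα : -1 < α) (hε : 0 < ε) (r : ℝ) :
    ∫⁻ η in Set.Ioc 0 ε, powWeight α (r - η) ≤
      ENNReal.ofReal ((2 ^ |α| + 2 / (α + 1)) * ε) * powWeight α r := by
  have hα1 : 0 < α + 1 := by linarith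
  rcases le_or_gt r 0 with hr | hr
  · refine (setLIntegral_mono measurable_const (g := fun _ => 0) fun η hη => ?_).trans (by simp)
    rw [powWeight_of_nonpos (by linarith [hη.1])]
  rw [powWeight_of_pos hr, ← ENNReal.ofReal_mul (by positivity)]
  -- If `r ≥ 2ε`, then `r - η ∈ [r/2, r]` and the weight changes by at most `2 ^ |α|`. Otherwise the
  -- full integral `r^{α+1} / (α+1)` of the weight over `(0, r)` is at most `2ε r^α / (α+1)`.
  rcases le_or_gt (2 * ε) r with h | h
  · have h1 : ∀ η ∈ Set.Ioc 0 ε, powWeight α (r - η) ≤ ENNReal.ofReal (2 ^ |α| * r ^ α) := by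
      intro η hη
      have hη0 := hη.1
      have hη1 := hη.2
      rw [powWeight_of_pos (by linarith)]
      refine ENNReal.ofReal_le_ofReal ?_
      rcases le_or_gt 0 α with h0 | h0
      · calc (r - η) ^ α ≤ r ^ α := Real.rpow_le_rpow (by linarith) (by linarith) h0
          _ ≤ 2 ^ |α| * r ^ α := le_mul_of_one_le_left (by positivity)
            (Real.one_le_rpow (by norm_num) (abs_nonneg _))
      · calc (r - η) ^ α ≤ (2⁻¹ * r) ^ α :=
            Real.rpow_le_rpow_of_nonpos (by positivity) (by linarith) h0.le
          _ = 2 ^ |α| * r ^ α := by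
            rw [Real.mul_rpow (by norm_num) hr.le, Real.inv_rpow (by norm_num),
              ← Real.rpow_neg (by norm_num), abs_of_neg h0]
    refine (setLIntegral_mono measurable_const h1).trans ?_
    rw [setLIntegral_const, Real.volume_Ioc, sub_zero, ← ENNReal.ofReal_mul (by positivity)]
    refine ENNReal.ofReal_le_ofReal ?_
    have : 0 ≤ 2 / (α + 1) * ε * r ^ α := by positivity
    linarith
  · calc ∫⁻ η in Set.Ioc 0 ε, powWeight α (r - η)
        ≤ ∫⁻ η, (Set.Iio r).indicator (powWeight α) (r - η) := by
          rw [← lintegral_indicator measurableSet_Ioc]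
          refine lintegral_mono fun η => ?_
          by_cases hη : η ∈ Set.Ioc 0 ε
          · rw [Set.indicator_of_mem hη, Set.indicator_of_mem (by simpa using hη.1)]
          · rw [Set.indicator_of_notMem hη]
            exact zero_le
      _ = ∫⁻ x, (Set.Iio r).indicator (powWeight α) x := lintegral_sub_left_eq_self _ r
      _ ≤ ∫⁻ x in Set.Ioc 0 r, ENNReal.ofReal (x ^ α) := by
          rw [← lintegral_indicator measurableSet_Ioc]
          refine lintegral_mono fun x => ?_
          by_cases hx : x < r
          · rw [Set.indicator_of_mem (Set.mem_Iio.2 hx)]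
            rcases le_or_gt x 0 with h0 | h0
            · rw [powWeight_of_nonpos h0]
              exact zero_le
            · rw [powWeight_of_pos h0, Set.indicator_of_mem (Set.mem_Ioc.2 ⟨h0, hx.le⟩)]
          · rw [Set.indicator_of_notMem (by simpa using hx)]
            exact zero_le
      _ = ENNReal.ofReal (r ^ (α + 1) / (α + 1)) := by
          have hint : IntegrableOn (fun x : ℝ => x ^ α) (Set.Ioc 0 r) :=
            (intervalIntegrable_iff_integrableOn_Ioc_of_le hr.le).1
              (intervalIntegral.intervalIntegrable_rpow' hα)
          rw [← ofReal_integral_eq_lintegral_ofReal hint, ← intervalIntegral.integral_of_le hr.le,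
            integral_rpow (Or.inl hα), Real.zero_rpow hα1.ne', sub_zero]
          exact (ae_restrict_iff' measurableSet_Ioc).2
            (ae_of_all _ fun x hx => Real.rpow_nonneg hx.1.le _)
      _ ≤ _ := by
          refine ENNReal.ofReal_le_ofReal ?_
          rw [Real.rpow_add hr, Real.rpow_one]
          have h1 : 0 ≤ 2 ^ |α| * ε * r ^ α := by positivity
          have h2 : r ^ α * r / (α + 1) ≤ r ^ α * (2 * ε) / (α + 1) := by gcongr
          have h3 : r ^ α * (2 * ε) / (α + 1) = 2 / (α + 1) * ε * r ^ α := by ring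
          linarith

theorem rhoDiag_add_smul_basePt {m : ℕ} (z : Fin (m + 1) → ℂ) (η : ℝ) :
    rhoDiag (z + η • basePt m) = rhoDiag z + η := by
  simp [rhoDiag, basePt]
  ring

theorem add_smul_basePt_mem_tube {m : ℕ} {z : Fin (m + 1) → ℂ} (hz : z ∈ tube m) {η : ℝ}
    (hη : 0 ≤ η) : z + η • basePt m ∈ tube m := by
  rw [mem_tube_iff] at *
  rw [rhoDiag_add_smul_basePt]
  linarith

/-- Vertical translations are bounded on `L¹(dV_α)` in the mean, for every `α > -1`. -/
theorem lintegral_lintegral_translate_le {m : ℕ} {α ε : ℝ} (hα : -1 < α) (hε : 0 < ε)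
    {g : (Fin (m + 1) → ℂ) → ENNReal} (hg : Measurable g) :
    ∫⁻ η in Set.Ioc 0 ε, ∫⁻ z, g (z + η • basePt m) ∂weightedVolume m α ≤
      ENNReal.ofReal ((2 ^ |α| + 2 / (α + 1)) * ε) * ∫⁻ z, g z ∂weightedVolume m α := by
  have hmeas : Measurable (rhoDiag (m := m)) := continuous_rhoDiag.measurable
  -- Invariance of Lebesgue measure moves the shift onto the weight, reducing the claim to one real
  -- variable.
  have h1 : ∀ η : ℝ, ∫⁻ z, g (z + η • basePt m) ∂weightedVolume m α =
      ∫⁻ z, powWeight α (rhoDiag z - η) * g z := by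
    intro η
    rw [lintegral_weightedVolume_eq_powWeight α (by fun_prop), ← lintegral_add_right_eq_self
      (fun z => powWeight α (rhoDiag z - η) * g z) (η • basePt m)]
    simp_rw [rhoDiag_add_smul_basePt, add_sub_cancel_right]
  simp_rw [h1]
  rw [lintegral_lintegral_swap (by fun_prop), lintegral_weightedVolume_eq_powWeight α hg,
    ← lintegral_const_mul _ (by fun_prop)]
  refine lintegral_mono fun z => ?_
  rw [lintegral_mul_const _ (by fun_prop), ← mul_assoc]
  gcongr
  exact lintegral_powWeight_sub_le hα hε _

theorem norm_basePt (m : ℕ) : ‖basePt m‖ = 1 := by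
  simp [basePt, Pi.norm_single]

theorem HasCompactSupport.exists_eLpNorm_translate_sub_le {m : ℕ}
    {ν : Measure (Fin (m + 1) → ℂ)} [IsLocallyFiniteMeasure ν] {g : (Fin (m + 1) → ℂ) → ℂ}
    (hg : HasCompactSupport g) (hgc : Continuous g) {p : ENNReal} {d : ℝ} (hd : 0 < d) :
    ∃ ε : ℝ, 0 < ε ∧ ε ≤ 1 ∧ ∀ η ∈ Set.Ioc 0 ε,
      eLpNorm (fun z => g (z + η • basePt m) - g z) p ν ≤ ENNReal.ofReal d := by
  -- All translates with `η ≤ 1` differ from `g` only inside this compact set.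
  set K := Metric.cthickening 1 (tsupport g)
  have hK : IsCompact K := IsCompact.cthickening hg
  have hKfin : ν K < ⊤ := hK.measure_lt_top
  set V := ν K ^ p.toReal⁻¹
  have hV : V ≠ ⊤ := ENNReal.rpow_ne_top_of_nonneg (by positivity) hKfin.ne
  set κ := d / (V.toReal + 1)
  have hκ : 0 < κ := by positivity
  obtain ⟨δ, hδ, hδg⟩ := Metric.uniformContinuous_iff.1
    (hg.uniformContinuous_of_continuous hgc) κ hκ
  refine ⟨min (δ / 2) 1, by positivity, min_le_right _ _, fun η hη => ?_⟩
  have hη0 := hη.1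
  have hη1 : η ≤ 1 := hη.2.trans (min_le_right _ _)
  have hη2 : η < δ := by linarith [hη.2.trans (min_le_left _ _)]
  have hdist : ∀ z : Fin (m + 1) → ℂ, dist (z + η • basePt m) z = η := fun z => by
    rw [dist_eq_norm, add_sub_cancel_left, norm_smul, norm_basePt, mul_one,
      Real.norm_of_nonneg hη0.le]
  have hsupp : Function.support (fun z => g (z + η • basePt m) - g z) ⊆ K := by
    intro z hz
    by_contra hzK
    refine hz ?_
    have h1 : g z = 0 := image_eq_zero_of_notMem_tsupport fun h =>
      hzK (Metric.self_subset_cthickening _ h)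
    have h2 : g (z + η • basePt m) = 0 := image_eq_zero_of_notMem_tsupport fun h =>
      hzK (Metric.mem_cthickening_of_dist_le _ _ _ _ h (by rw [dist_comm, hdist]; exact hη1))
    simp [h1, h2]
  rw [← eLpNorm_restrict_eq_of_support_subset hsupp]
  refine (eLpNorm_le_of_ae_bound (C := κ) (ae_of_all _ fun z => ?_)).trans ?_
  · rw [← dist_eq_norm]
    exact (hδg (by rw [hdist]; exact hη2)).le
  · rw [Measure.restrict_apply_univ, show ν K ^ p.toReal⁻¹ = ENNReal.ofReal V.toReal from
        (ENNReal.ofReal_toReal hV).symm,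
      ← ENNReal.ofReal_mul ENNReal.toReal_nonneg]
    refine ENNReal.ofReal_le_ofReal ?_
    rw [mul_div_assoc', div_le_iff₀ (by positivity)]
    nlinarith [ENNReal.toReal_nonneg (a := V)]

/-- An `L^p(dV_α)` function is approximated by one of its small vertical translates. -/
theorem exists_eLpNorm_translate_sub_lt {m : ℕ} {p α : ℝ} (hp : 1 ≤ p) (hα : -1 < α)
    {f : (Fin (m + 1) → ℂ) → ℂ} (hf : Measurable f)
    (hfp : MemLp f (ENNReal.ofReal p) (weightedVolume m α)) {κ : ℝ} (hκ : 0 < κ) :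
    ∃ η : ℝ, 0 < η ∧ η ≤ 1 ∧ eLpNorm (fun z => f (z + η • basePt m) - f z) (ENNReal.ofReal p)
      (weightedVolume m α) < ENNReal.ofReal κ := by
  have hp0 : 0 < p := by linarith
  have hα1 : 0 < α + 1 := by linarith
  have hq0 : ENNReal.ofReal p ≠ 0 := by simpa using hp0
  have hq1 : 1 ≤ ENNReal.ofReal p := by simpa using hp
  have := isLocallyFiniteMeasure_weightedVolume (m := m) hα
  set ν := weightedVolume m α
  set C : ℝ := 2 ^ |α| + 2 / (α + 1)
  have hC1 : 1 ≤ C := by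
    have h1 : (1 : ℝ) ≤ 2 ^ |α| := Real.one_le_rpow (by norm_num) (abs_nonneg _)
    have h2 : 0 ≤ 2 / (α + 1) := by positivity
    simp only [C]; linarith
  -- The three errors below are at most `C d`, `d` and `d`, with sum `(C + 2) d < κ`.
  set d := κ / (C + 3)
  have hd : 0 < d := by positivity
  obtain ⟨g, hgs, hfg, hgc, hgp⟩ := hfp.exists_hasCompactSupport_eLpNorm_sub_le
    ENNReal.ofReal_ne_top (ε := ENNReal.ofReal d) (by simpa using hd)
  obtain ⟨ε, hε, hε1, hεg⟩ := hgs.exists_eLpNorm_translate_sub_le hgc (ν := ν)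
    (p := ENNReal.ofReal p) hd
  set h : (Fin (m + 1) → ℂ) → ENNReal := fun z => ‖(f - g) z‖ₑ ^ p
  have hh : Measurable h := (hf.sub hgc.measurable).enorm.pow_const p
  have hhint : ∫⁻ z, h z ∂ν ≤ ENNReal.ofReal d ^ p := by
    have := eLpNorm_eq_lintegral_rpow_enorm_toReal (f := f - g) (μ := ν) hq0 ENNReal.ofReal_ne_top
    rw [ENNReal.toReal_ofReal hp0.le] at this
    rw [this, one_div, ENNReal.rpow_inv_le_iff hp0] at hfg
    exact hfg
  have havg := lintegral_lintegral_translate_le hα hε hh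
  -- Some `η` does no worse than the average, which is all that is controlled when `α < 0`.
  obtain ⟨η, hη, hηle⟩ := exists_le_setLAverage (μ := volume) (s := Set.Ioc 0 ε)
    (f := fun η : ℝ => ∫⁻ z, h (z + η • basePt m) ∂ν) (by simpa using hε) (by simp)
    (Measurable.lintegral_prod_right' (f := fun q : ℝ × (Fin (m + 1) → ℂ) =>
      h (q.2 + q.1 • basePt m)) (by fun_prop)).aemeasurable
  refine ⟨η, hη.1, hη.2.trans hε1, ?_⟩
  have hη3 : ∫⁻ z, h (z + η • basePt m) ∂ν ≤ ENNReal.ofReal (C * d) ^ p := by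
    refine hηle.trans ?_
    rw [setLAverage_eq, Real.volume_Ioc, sub_zero]
    refine ENNReal.div_le_of_le_mul (havg.trans ?_)
    calc ENNReal.ofReal (C * ε) * ∫⁻ z, h z ∂ν
        ≤ ENNReal.ofReal (C * ε) * ENNReal.ofReal d ^ p := by gcongr
      _ = ENNReal.ofReal (C * d ^ p * ε) := by
        rw [ENNReal.ofReal_rpow_of_nonneg hd.le hp0.le, ← ENNReal.ofReal_mul (by positivity)]
        ring_nf
      _ ≤ ENNReal.ofReal ((C * d) ^ p * ε) := by
        refine ENNReal.ofReal_le_ofReal ?_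
        rw [Real.mul_rpow (by positivity) hd.le]
        gcongr
        exact Real.self_le_rpow_of_one_le hC1 hp
      _ = ENNReal.ofReal (C * d) ^ p * ENNReal.ofReal ε := by
        rw [ENNReal.ofReal_rpow_of_nonneg (by positivity) hp0.le, ← ENNReal.ofReal_mul (by positivity)]
  have hη4 : eLpNorm (fun z => (f - g) (z + η • basePt m)) (ENNReal.ofReal p) ν ≤
      ENNReal.ofReal (C * d) := by
    rw [eLpNorm_eq_lintegral_rpow_enorm_toReal hq0 ENNReal.ofReal_ne_top,
      ENNReal.toReal_ofReal hp0.le, one_div, ENNReal.rpow_inv_le_iff hp0]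
    exact hη3
  have hm1 : Measurable fun z : Fin (m + 1) → ℂ => (f - g) (z + η • basePt m) :=
    (hf.sub hgc.measurable).comp (measurable_id.add_const _)
  have hm2 : Measurable fun z : Fin (m + 1) → ℂ => g (z + η • basePt m) - g z :=
    (hgc.measurable.comp (measurable_id.add_const _)).sub hgc.measurable
  have hsplit : (fun z => f (z + η • basePt m) - f z) =
      ((fun z => (f - g) (z + η • basePt m)) + fun z => g (z + η • basePt m) - g z) - (f - g) := by
    ext z
    simp
  calc eLpNorm (fun z => f (z + η • basePt m) - f z) (ENNReal.ofReal p) ν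
      ≤ ENNReal.ofReal (C * d) + ENNReal.ofReal d + ENNReal.ofReal d := by
        rw [hsplit]
        refine (eLpNorm_sub_le (hm1.add hm2).aestronglyMeasurable
          (hf.sub hgc.measurable).aestronglyMeasurable hq1).trans ?_
        gcongr
        refine (eLpNorm_add_le hm1.aestronglyMeasurable hm2.aestronglyMeasurable hq1).trans ?_
        gcongr
        exact hεg η hη
    _ = ENNReal.ofReal ((C + 2) * d) := by
        rw [← ENNReal.ofReal_add (by positivity) hd.le, ← ENNReal.ofReal_add (by positivity) hd.le]
        ring_nf
    _ < ENNReal.ofReal κ := by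
        refine (ENNReal.ofReal_lt_ofReal_iff hκ).2 ?_
        simp only [d]
        rw [mul_div_assoc', div_lt_iff₀ (by positivity)]
        nlinarith

/-! ### Mean value inequality and polynomial growth of translates -/

theorem measurePreserving_circle_smul {ι : Type*} [Fintype ι] {a : ℂ} (ha : ‖a‖ = 1) :
    MeasurePreserving (fun v : ι → ℂ => a • v) := by
  have h := (rotation ⟨a, mem_sphere_zero_iff_norm.2 ha⟩).measurePreserving
  exact volume_preserving_pi fun _ : ι => h

/-- Mean value inequality on polydiscs. -/
theorem DifferentiableOn.enorm_mul_volume_ball_le {ι : Type*} [Fintype ι] {f : (ι → ℂ) → ℂ}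
    (hf : Measurable f) {c : ι → ℂ} {r : ℝ} (hd : DifferentiableOn ℂ f (Metric.ball c r)) :
    ‖f c‖ₑ * volume (Metric.ball c r) ≤ ∫⁻ w in Metric.ball c r, ‖f w‖ₑ := by
  let G : (ι → ℂ) → ENNReal := (Metric.ball c r).indicator fun w => ‖f w‖ₑ
  have hG : Measurable G := hf.enorm.indicator Metric.isOpen_ball.measurableSet
  have hball : ∀ v : ι → ℂ, c + v ∈ Metric.ball c r ↔ v ∈ Metric.ball 0 r := fun v => by simp
  -- This is the one-variable mean value property on the complex disc `ζ ↦ c + ζ v`; integrating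
  -- over `v` and using rotation invariance gives the claim.
  have hmv : ∀ v ∈ Metric.ball (0 : ι → ℂ) r, ENNReal.ofReal (2 * Real.pi) * ‖f c‖ₑ ≤
      ∫⁻ θ in Set.Ioc 0 (2 * Real.pi), G (c + circleMap 0 1 θ • v) := by
    intro v hv
    have hmem : ∀ ζ ∈ Metric.closedBall (0 : ℂ) 1, c + ζ • v ∈ Metric.ball c r := fun ζ hζ => by
      rw [hball, mem_ball_zero_iff, norm_smul]
      rw [mem_ball_zero_iff] at hv
      rw [mem_closedBall_zero_iff] at hζ
      exact (mul_le_of_le_one_left (norm_nonneg _) hζ).trans_lt hv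
    have hφ : DiffContOnCl ℂ (fun ζ : ℂ => f (c + ζ • v)) (Metric.ball 0 |1|) := by
      refine DifferentiableOn.diffContOnCl ?_
      rw [abs_one, closure_ball _ one_ne_zero]
      exact hd.comp (by fun_prop) hmem
    have h1 := hφ.circleAverage
    rw [Real.circleAverage, zero_smul, add_zero,
      intervalIntegral.integral_of_le (by positivity)] at h1
    have h2 : ENNReal.ofReal (2 * Real.pi) * ‖f c‖ₑ =
        ‖∫ θ in Set.Ioc 0 (2 * Real.pi), f (c + circleMap 0 1 θ • v)‖ₑ := by
      rw [← h1, enorm_smul, ← mul_assoc, enorm_inv (by positivity),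
        Real.enorm_of_nonneg (by positivity), ENNReal.mul_inv_cancel, one_mul]
      · simpa using Real.pi_pos
      · exact ENNReal.ofReal_ne_top
    rw [h2]
    refine (enorm_integral_le_lintegral_enorm _).trans_eq (lintegral_congr fun θ => ?_)
    simp only [G]
    rw [Set.indicator_of_mem (hmem _ (by simp))]
  have hint : ∀ θ : ℝ, ∫⁻ v, G (c + circleMap 0 1 θ • v) = ∫⁻ w in Metric.ball c r, ‖f w‖ₑ := by
    intro θ
    rw [← lintegral_indicator Metric.isOpen_ball.measurableSet]
    rw [(measurePreserving_circle_smul (a := circleMap 0 1 θ) (by simp)).lintegral_comp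
      (f := fun v : ι → ℂ => G (c + v)) (by fun_prop)]
    exact lintegral_add_left_eq_self _ c
  have hcirc : Continuous fun q : (ι → ℂ) × ℝ => c + circleMap 0 1 q.2 • q.1 := by fun_prop
  have hvol : volume (Metric.ball c r) = volume (Metric.ball (0 : ι → ℂ) r) :=
    Measure.addHaar_ball_center _ _ _
  have key : ENNReal.ofReal (2 * Real.pi) * ‖f c‖ₑ * volume (Metric.ball (0 : ι → ℂ) r) ≤
      ENNReal.ofReal (2 * Real.pi) * ∫⁻ w in Metric.ball c r, ‖f w‖ₑ := by
    calc _ = ∫⁻ v in Metric.ball (0 : ι → ℂ) r, ENNReal.ofReal (2 * Real.pi) * ‖f c‖ₑ :=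
          (setLIntegral_const _ _).symm
      _ ≤ ∫⁻ v in Metric.ball (0 : ι → ℂ) r,
            ∫⁻ θ in Set.Ioc 0 (2 * Real.pi), G (c + circleMap 0 1 θ • v) :=
          setLIntegral_mono' Metric.isOpen_ball.measurableSet hmv
      _ ≤ ∫⁻ v, ∫⁻ θ in Set.Ioc 0 (2 * Real.pi), G (c + circleMap 0 1 θ • v) :=
          setLIntegral_le_lintegral _ _
      _ = ∫⁻ θ in Set.Ioc 0 (2 * Real.pi), ∫⁻ v, G (c + circleMap 0 1 θ • v) :=
          lintegral_lintegral_swap (hG.comp hcirc.measurable).aemeasurable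
      _ = _ := by
          simp_rw [hint]
          rw [setLIntegral_const, Real.volume_Ioc, sub_zero, mul_comm]
  rw [hvol]
  rw [mul_assoc] at key
  exact (ENNReal.mul_le_mul_iff_right (by simpa using Real.pi_pos) ENNReal.ofReal_ne_top).1 key

theorem abs_im_le_norm_rho_basePt {m : ℕ} {z : Fin (m + 1) → ℂ} (hz : z ∈ tube m) (k : Fin m) :
    |(z k.castSucc).im| ≤ 6 * ‖rho z (basePt m)‖ := by
  have h1 := norm_sub_sq_le hz (basePt_mem_tube m) k
  have h2 : basePt m k.castSucc = 0 := by simp [basePt]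
  rw [h2, sub_zero] at h1
  have h3 := Complex.abs_im_le_norm (z k.castSucc)
  have h4 := half_lt_norm_rho_basePt hz
  nlinarith [sq_nonneg (‖z k.castSucc‖ - 1)]

/-- The quadratic term makes the Lipschitz constant of `ρ` grow linearly in `|y'|`, so usable balls
must shrink like its inverse. -/
theorem abs_rhoDiag_sub_le {m : ℕ} {z w : Fin (m + 1) → ℂ} {r : ℝ} (hr1 : r ≤ 1)
    (hw : w ∈ Metric.ball z r) :
    |rhoDiag w - rhoDiag z| ≤ r * (1 + m + 2 * ∑ k : Fin m, |(z k.castSucc).im|) := by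
  have hr : 0 < r := Metric.pos_of_mem_ball hw
  have him : ∀ k, |(w k).im - (z k).im| ≤ r := fun k => by
    rw [← Complex.sub_im]
    refine (Complex.abs_im_le_norm _).trans ((norm_le_pi_norm (w - z) k).trans ?_)
    rw [← dist_eq_norm]
    exact (Metric.mem_ball.1 hw).le
  have hk : ∀ k : Fin m, |((w k.castSucc).im) ^ 2 - ((z k.castSucc).im) ^ 2| ≤
      r * (1 + 2 * |(z k.castSucc).im|) := by
    intro k
    have h1 := him k.castSucc
    set a := (w k.castSucc).im
    set b := (z k.castSucc).im
    have h2 : |a + b| ≤ 1 + 2 * |b| := by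
      calc |a + b| = |(a - b) + 2 * b| := by ring_nf
        _ ≤ |a - b| + |2 * b| := abs_add_le _ _
        _ ≤ 1 + 2 * |b| := by rw [abs_mul, abs_two]; linarith
    calc |a ^ 2 - b ^ 2| = |a - b| * |a + b| := by rw [← abs_mul]; ring_nf
      _ ≤ r * (1 + 2 * |b|) := by gcongr
  have hsum : |∑ k : Fin m, (((w k.castSucc).im) ^ 2 - ((z k.castSucc).im) ^ 2)| ≤
      ∑ k : Fin m, r * (1 + 2 * |(z k.castSucc).im|) :=
    (Finset.abs_sum_le_sum_abs _ _).trans (Finset.sum_le_sum fun k _ => hk k)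
  have hrw : ∑ k : Fin m, r * (1 + 2 * |(z k.castSucc).im|) =
      r * (m + 2 * ∑ k : Fin m, |(z k.castSucc).im|) := by
    rw [← Finset.mul_sum, Finset.sum_add_distrib, ← Finset.mul_sum]
    simp
  rw [hrw] at hsum
  have heq : rhoDiag w - rhoDiag z = ((w (Fin.last m)).im - (z (Fin.last m)).im) -
      ∑ k : Fin m, (((w k.castSucc).im) ^ 2 - ((z k.castSucc).im) ^ 2) := by
    rw [Finset.sum_sub_distrib]
    simp only [rhoDiag]
    ring
  rw [heq]
  refine (abs_sub _ _).trans ?_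
  linarith [him (Fin.last m)]

theorem rpow_neg_le_div_pow {α a b x : ℝ} (ha : 0 < a) (ha1 : a ≤ 1) (hb1 : 1 ≤ b) (hax : a ≤ x)
    (hxb : x ≤ b) : x ^ (-α) ≤ (b / a) ^ ⌈|α|⌉₊ := by
  have hx : 0 < x := ha.trans_le hax
  have hba : 1 ≤ b / a := by
    rw [one_le_div ha]
    linarith
  refine le_trans ?_ ((Real.rpow_le_rpow_of_exponent_le hba (Nat.le_ceil |α|)).trans_eq
    (Real.rpow_natCast _ _))
  rcases le_or_gt 0 α with h | h
  · rw [abs_of_nonneg h, Real.rpow_neg hx.le, ← Real.inv_rpow hx.le]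
    refine Real.rpow_le_rpow (by positivity) ?_ h
    rw [inv_le_iff_one_le_mul₀ hx, div_mul_eq_mul_div, one_le_div ha]
    nlinarith
  · rw [abs_of_neg h]
    refine Real.rpow_le_rpow hx.le ?_ (by linarith)
    rw [le_div_iff₀ ha]
    nlinarith

/-- Vertical translates of `A^p_α` functions have at most polynomial growth. -/
theorem exists_norm_translate_le {m : ℕ} {p α : ℝ} (hp : 1 ≤ p) {f : (Fin (m + 1) → ℂ) → ℂ}
    (hf : Measurable f) (hd : DifferentiableOn ℂ f (tube m))
    (hfp : MemLp f (ENNReal.ofReal p) (weightedVolume m α)) {η : ℝ} (hη : 0 < η) (hη1 : η ≤ 1) :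
    ∃ (C : ℝ) (N : ℕ), ∀ z ∈ tube m, ‖f (z + η • basePt m)‖ ≤ C * ‖rho z (basePt m)‖ ^ N := by
  have hp0 : 0 < p := by linarith
  have hI : ∫⁻ z, ‖f z‖ₑ ^ p ∂weightedVolume m α < ⊤ := by
    have := hfp.2
    rwa [eLpNorm_lt_top_iff_lintegral_rpow_enorm_lt_top (by simpa using hp0) ENNReal.ofReal_ne_top,
      ENNReal.toReal_ofReal hp0.le] at this
  set I := ∫⁻ z, ‖f z‖ₑ ^ p ∂weightedVolume m α with hIdef
  set N₀ := ⌈|α|⌉₊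
  set D := Module.finrank ℝ (Fin (m + 1) → ℂ)
  set v₀ := volume (Metric.ball (0 : Fin (m + 1) → ℂ) 1)
  have hv₀ : 0 < v₀ := Metric.measure_ball_pos _ _ one_pos
  have hv₀' : v₀ < ⊤ := measure_ball_lt_top
  have hv₀r : 0 < v₀.toReal := ENNReal.toReal_pos hv₀.ne' hv₀'.ne
  set B : ℝ := 2 * (2 + 14 * m) / η
  refine ⟨2 ^ (N₀ + D) + (8 / η) ^ N₀ * B ^ D * (I.toReal / v₀.toReal), N₀ + D, fun z hz => ?_⟩
  set R := ‖rho z (basePt m)‖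
  have hR : 1 / 2 < R := half_lt_norm_rho_basePt hz
  have hρz := mem_tube_iff.1 hz
  have hρR : rhoDiag z + 1 ≤ 2 * R := by
    have := rhoDiag_add_le_norm_rho z (basePt m)
    rwa [rhoDiag_basePt] at this
  set c := z + η • basePt m
  have hc : rhoDiag c = rhoDiag z + η := rhoDiag_add_smul_basePt z η
  have hcim : ∀ k : Fin m, (c k.castSucc).im = (z k.castSucc).im := fun k => by
    simp [c, basePt]
  set Q := 1 + m + 2 * ∑ k : Fin m, |(c k.castSucc).im|
  have hQ1 : 1 ≤ Q := by
    have : 0 ≤ ∑ k : Fin m, |(c k.castSucc).im| := by positivity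
    have := (Nat.cast_nonneg m : (0 : ℝ) ≤ m)
    simp only [Q]; linarith
  have hQR : Q ≤ (2 + 14 * m) * R := by
    have h1 : ∑ k : Fin m, |(c k.castSucc).im| ≤ m * (6 * R) := by
      refine (Finset.sum_le_card_nsmul _ _ (6 * R) fun k _ => ?_).trans_eq
        (by rw [Finset.card_univ, Fintype.card_fin, nsmul_eq_mul])
      rw [hcim]
      exact abs_im_le_norm_rho_basePt hz k
    have h2 := (Nat.cast_nonneg m : (0 : ℝ) ≤ m)
    simp only [Q]
    nlinarith
  -- With this radius `ρ` varies by at most `η / 2` on the ball, hence stays above `η / 2`; and `1 /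
  -- r` is `O(R)`, so volumes cost only powers of `R`.
  set r := η / (2 * Q)
  have hr : 0 < r := by positivity
  have hr1 : r ≤ 1 := by
    simp only [r]
    rw [div_le_one (by positivity)]
    linarith
  have hrQ : r * Q = η / 2 := by
    simp only [r]
    field_simp
  have hball : ∀ w ∈ Metric.ball c r, η / 2 ≤ rhoDiag w ∧ rhoDiag w ≤ 4 * R := by
    intro w hw
    have h := abs_le.1 (abs_rhoDiag_sub_le hr1 hw)
    rw [hrQ, hc] at h
    constructor <;> linarith
  have hballt : Metric.ball c r ⊆ tube m := fun w hw => mem_tube_iff.2 (by linarith [(hball w hw).1])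
  set L := (8 * R / η) ^ N₀
  have hL : 0 ≤ L := by positivity
  have hweight : ∀ w ∈ Metric.ball c r, 1 ≤ L * rhoDiag w ^ α := by
    intro w hw
    obtain ⟨h1, h2⟩ := hball w hw
    have hρ : 0 < rhoDiag w := by linarith
    have h3 := rpow_neg_le_div_pow (α := α) (by positivity) (by linarith) (by linarith) h1 h2
    rw [show 4 * R / (η / 2) = 8 * R / η by field_simp; norm_num, Real.rpow_neg hρ.le,
      inv_le_iff_one_le_mul₀ (by positivity)] at h3
    exact h3
  have hmv := (hd.mono hballt).enorm_mul_volume_ball_le hf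
  have hle : ∫⁻ w in Metric.ball c r, ‖f w‖ₑ ≤ volume (Metric.ball c r) + ENNReal.ofReal L * I := by
    calc ∫⁻ w in Metric.ball c r, ‖f w‖ₑ
        ≤ ∫⁻ w in Metric.ball c r,
            (1 + ENNReal.ofReal L * (ENNReal.ofReal (rhoDiag w ^ α) * ‖f w‖ₑ ^ p)) := by
          refine setLIntegral_mono' Metric.isOpen_ball.measurableSet fun w hw => ?_
          -- This crude bound replaces Hölder's inequality, as only polynomial growth is wanted.
          have h1 : ‖f w‖ₑ ≤ 1 + ‖f w‖ₑ ^ p := by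
            rcases le_total ‖f w‖ₑ 1 with h | h
            · exact h.trans le_self_add
            · refine le_trans ?_ le_add_self
              simpa using ENNReal.rpow_le_rpow_of_exponent_le h hp
          refine h1.trans ?_
          gcongr
          rw [← mul_assoc, ← ENNReal.ofReal_mul hL]
          exact le_mul_of_one_le_left zero_le (by simpa using hweight w hw)
      _ ≤ _ := by
          rw [lintegral_add_left measurable_const, setLIntegral_const, one_mul,
            lintegral_const_mul' _ _ ENNReal.ofReal_ne_top, hIdef,
            lintegral_weightedVolume α (hf.enorm.pow_const p)]
          gcongr
  have hvol : volume (Metric.ball c r) = ENNReal.ofReal (r ^ D) * v₀ :=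
    Measure.addHaar_ball volume c hr.le
  have hreal : ‖f c‖ * (r ^ D * v₀.toReal) ≤ r ^ D * v₀.toReal + L * I.toReal := by
    have h := hmv.trans hle
    rw [hvol, ← ofReal_norm, ← ENNReal.ofReal_toReal hv₀'.ne, ← ENNReal.ofReal_toReal hI.ne,
      ← ENNReal.ofReal_mul (by positivity), ← ENNReal.ofReal_mul (by positivity),
      ← ENNReal.ofReal_mul (by positivity), ← ENNReal.ofReal_add (by positivity) (by positivity)] at h
    exact (ENNReal.ofReal_le_ofReal_iff (by positivity)).1 h
  have hrinv : r⁻¹ ≤ B * R := by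
    simp only [r, B]
    rw [inv_div, div_mul_eq_mul_div]
    refine div_le_div_of_nonneg_right ?_ hη.le
    linarith
  have hI0 : 0 ≤ I.toReal := ENNReal.toReal_nonneg
  have h1 : ‖f c‖ ≤ 1 + L * (r⁻¹) ^ D * (I.toReal / v₀.toReal) := by
    have h2 : 0 < r ^ D * v₀.toReal := by positivity
    rw [← le_div_iff₀ h2] at hreal
    refine hreal.trans_eq ?_
    rw [add_div, div_self h2.ne', inv_pow]
    field_simp
  calc ‖f c‖ ≤ 1 + L * (r⁻¹) ^ D * (I.toReal / v₀.toReal) := h1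
    _ ≤ (2 * R) ^ (N₀ + D) + L * (B * R) ^ D * (I.toReal / v₀.toReal) := by
        gcongr
        exact one_le_pow₀ (by linarith)
    _ = _ := by
        simp only [L]
        rw [mul_pow, show 8 * R / η = 8 / η * R by ring, mul_pow, mul_pow, pow_add, pow_add]
        ring

/-! ### Damping by powers of `1 + δ ρ(·, 𝐢)`, and density -/

theorem one_le_norm_one_add_mul_rho {m : ℕ} {z : Fin (m + 1) → ℂ} (hz : z ∈ tube m) {δ : ℝ}
    (hδ : 0 ≤ δ) : 1 ≤ ‖1 + (δ : ℂ) * rho z (basePt m)‖ := by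
  have h := Complex.re_le_norm (1 + (δ : ℂ) * rho z (basePt m))
  rw [Complex.add_re, Complex.one_re, Complex.re_ofReal_mul] at h
  have := mul_nonneg hδ (re_rho_pos hz (basePt_mem_tube m)).le
  linarith

theorem mul_norm_rho_le_norm_one_add {m : ℕ} {z : Fin (m + 1) → ℂ} (hz : z ∈ tube m) {δ : ℝ}
    (hδ : 0 ≤ δ) : δ * ‖rho z (basePt m)‖ ≤ ‖1 + (δ : ℂ) * rho z (basePt m)‖ := by
  have h := mul_nonneg hδ (re_rho_pos hz (basePt_mem_tube m)).le
  have h1 : δ * ‖rho z (basePt m)‖ = ‖(δ : ℂ) * rho z (basePt m)‖ := by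
    rw [norm_mul, Complex.norm_real, Real.norm_of_nonneg hδ]
  rw [h1, Complex.norm_def, Complex.norm_def]
  -- Adding `1` to a number with nonnegative real part increases its modulus.
  refine Real.sqrt_le_sqrt ?_
  rw [Complex.normSq_apply, Complex.normSq_apply, Complex.add_re, Complex.add_im, Complex.one_re,
    Complex.one_im, zero_add, Complex.re_ofReal_mul]
  nlinarith

/-- Functions of polynomial growth become members of `S_t` after multiplication by a high power of
`(1 + δ ρ(·, 𝐢))⁻¹`. -/
theorem div_one_add_rho_pow_mem_decaySpace {m : ℕ} {h : (Fin (m + 1) → ℂ) → ℂ}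
    (hd : DifferentiableOn ℂ h (tube m)) {C : ℝ} {N M : ℕ} {t : ℝ}
    (hC : ∀ z ∈ tube m, ‖h z‖ ≤ C * ‖rho z (basePt m)‖ ^ N) (hM : t + N ≤ M) {δ : ℝ} (hδ : 0 < δ) :
    (fun z => h z / (1 + (δ : ℂ) * rho z (basePt m)) ^ M) ∈ decaySpace m t := by
  have hne : ∀ z ∈ tube m, (1 + (δ : ℂ) * rho z (basePt m)) ^ M ≠ 0 := fun z hz =>
    pow_ne_zero _ (norm_pos_iff.1 (one_pos.trans_le (one_le_norm_one_add_mul_rho hz hδ.le)))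
  have hC0 : 0 ≤ C := by
    have h1 := (norm_nonneg _).trans (hC _ (basePt_mem_tube m))
    exact nonneg_of_mul_nonneg_left h1
      (pow_pos (norm_rho_pos (basePt_mem_tube m) (basePt_mem_tube m)) _)
  have hpd : DifferentiableOn ℂ (fun z => (1 + (δ : ℂ) * rho z (basePt m)) ^ M) (tube m) := by
    have := differentiable_rho_left (basePt m)
    exact (by fun_prop : Differentiable ℂ fun z => (1 + (δ : ℂ) * rho z (basePt m)) ^ M).differentiableOn
  have hdd : DifferentiableOn ℂ (fun z => h z / (1 + (δ : ℂ) * rho z (basePt m)) ^ M) (tube m) := by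
    simp_rw [div_eq_mul_inv]
    exact hd.mul (hpd.inv hne)
  refine ⟨hdd, 2 ^ (0 - (t + N - M)) * (C / δ ^ M), fun z hz => ?_⟩
  have hR := norm_rho_pos hz (basePt_mem_tube m)
  have hpow := norm_rho_basePt_rpow_le hz (s := t + N - M) (t := 0) (by linarith)
  rw [Real.rpow_zero, mul_one] at hpow
  set R := ‖rho z (basePt m)‖
  rw [norm_div, norm_pow]
  calc R ^ t * (‖h z‖ / ‖1 + (δ : ℂ) * rho z (basePt m)‖ ^ M)
      ≤ R ^ t * (C * R ^ N / (δ * R) ^ M) := by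
        gcongr
        · exact hC z hz
        · exact mul_norm_rho_le_norm_one_add hz hδ.le
    _ = R ^ (t + N - M) * (C / δ ^ M) := by
        rw [Real.rpow_sub hR, Real.rpow_add hR, Real.rpow_natCast, Real.rpow_natCast, mul_pow]
        field_simp
    _ ≤ _ := by gcongr

/-- Dominated convergence along `δ = 1 / (j + 1)`: the damping factor has modulus at most `1` and
tends to `1`, so `(2 |h|)^p` dominates. -/
theorem exists_eLpNorm_div_one_add_rho_pow_sub_lt {m : ℕ} {p α : ℝ} (hp : 1 ≤ p)
    {h : (Fin (m + 1) → ℂ) → ℂ} (hm : Measurable h)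
    (hhp : MemLp h (ENNReal.ofReal p) (weightedVolume m α)) (M : ℕ) {κ : ℝ} (hκ : 0 < κ) :
    ∃ δ : ℝ, 0 < δ ∧ eLpNorm (fun z => h z / (1 + (δ : ℂ) * rho z (basePt m)) ^ M - h z)
      (ENNReal.ofReal p) (weightedVolume m α) < ENNReal.ofReal κ := by
  have hp0 : 0 < p := by linarith
  have hq0 : ENNReal.ofReal p ≠ 0 := by simpa using hp0
  have hρm := (continuous_rho_left (basePt m)).measurable
  let F : ℕ → (Fin (m + 1) → ℂ) → ENNReal := fun j z =>
    ‖h z / (1 + ((1 / ((j : ℝ) + 1) : ℝ) : ℂ) * rho z (basePt m)) ^ M - h z‖ₑ ^ p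
  have hlim : Tendsto (fun j => ∫⁻ z, F j z ∂weightedVolume m α) atTop (𝓝 0) := by
    have hbd : ∫⁻ z, (2 * ‖h z‖ₑ) ^ p ∂weightedVolume m α ≠ ⊤ := by
      have := hhp.2
      rw [eLpNorm_lt_top_iff_lintegral_rpow_enorm_lt_top hq0 ENNReal.ofReal_ne_top,
        ENNReal.toReal_ofReal hp0.le] at this
      simp_rw [ENNReal.mul_rpow_of_nonneg _ _ hp0.le]
      rw [lintegral_const_mul' _ _ (by simp)]
      exact ENNReal.mul_ne_top (by simp) this.ne
    have := tendsto_lintegral_of_dominated_convergence (F := F) (f := fun _ => 0)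
      (μ := weightedVolume m α) (fun z => (2 * ‖h z‖ₑ) ^ p)
      (fun j => by simp only [F]; fun_prop) (fun j => ?_) hbd ?_
    · simpa using this
    · filter_upwards [ae_weightedVolume_mem α] with z hz
      simp only [F]
      gcongr
      refine (enorm_sub_le).trans ?_
      rw [two_mul]
      gcongr
      rw [← ofReal_norm, ← ofReal_norm, norm_div, norm_pow]
      refine ENNReal.ofReal_le_ofReal (div_le_self (norm_nonneg _) ?_)
      exact one_le_pow₀ (one_le_norm_one_add_mul_rho hz (by positivity))
    · refine ae_of_all _ fun z => ?_
      have h1 : Tendsto (fun j : ℕ => ((1 / ((j : ℝ) + 1) : ℝ) : ℂ)) atTop (𝓝 ((0 : ℝ) : ℂ)) :=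
        (Complex.continuous_ofReal.tendsto 0).comp tendsto_one_div_add_atTop_nhds_zero_nat
      have h2 : ContinuousAt (fun d : ℂ =>
          ‖h z / (1 + d * rho z (basePt m)) ^ M - h z‖ₑ ^ p) ((0 : ℝ) : ℂ) := by
        have h3 : ContinuousAt (fun d : ℂ => h z / (1 + d * rho z (basePt m)) ^ M - h z)
            ((0 : ℝ) : ℂ) := by
          refine (continuousAt_const.div (by fun_prop) (by simp)).sub continuousAt_const
        exact (ENNReal.continuous_rpow_const.comp continuous_enorm).continuousAt.comp h3
      have h4 := h2.tendsto.comp h1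
      simpa [F, Function.comp_def, hp0] using h4
  have hκp : 0 < ENNReal.ofReal κ ^ p := ENNReal.rpow_pos (by simpa using hκ) ENNReal.ofReal_ne_top
  obtain ⟨j, hj⟩ := (hlim.eventually_lt_const hκp).exists
  refine ⟨1 / ((j : ℝ) + 1), by positivity, ?_⟩
  rw [eLpNorm_eq_lintegral_rpow_enorm_toReal hq0 ENNReal.ofReal_ne_top,
    ENNReal.toReal_ofReal hp0.le, one_div p, ENNReal.rpow_inv_lt_iff hp0]
  exact hj

theorem isDenseInBergman_decaySpace {m : ℕ} {p α : ℝ} (hp : 1 ≤ p) (hα : -1 < α) (t : ℝ) :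
    IsDenseInBergman ((decaySpace m t).submoduleOf (bergmanSpace m p α)) := by
  rintro ⟨f, hfd, hfp⟩ ε hε
  have hq1 : 1 ≤ ENNReal.ofReal p := by simpa using hp
  -- Values off the tube are arbitrary; cutting them off makes the function globally measurable, as
  -- translation and Tonelli require.
  set F := (tube m).indicator f
  have hFf : ∀ z ∈ tube m, F z = f z := fun z hz => Set.indicator_of_mem hz f
  have hFm : Measurable F := by
    classical
    exact hfd.continuousOn.measurable_piecewise continuousOn_const (measurableSet_tube m)
  have hFd : DifferentiableOn ℂ F (tube m) := hfd.congr hFf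
  have hae : F =ᵐ[weightedVolume m α] f := by
    filter_upwards [ae_weightedVolume_mem α] with z hz
    exact hFf z hz
  have hFp : MemLp F (ENNReal.ofReal p) (weightedVolume m α) := (memLp_congr_ae hae).2 hfp
  obtain ⟨η, hη, hη1, hclose⟩ := exists_eLpNorm_translate_sub_lt hp hα hFm hFp (half_pos hε)
  set h : (Fin (m + 1) → ℂ) → ℂ := fun z => F (z + η • basePt m)
  have hhm : Measurable h := hFm.comp (measurable_id.add_const _)
  have hhd : DifferentiableOn ℂ h (tube m) :=
    hFd.comp (by fun_prop) fun z hz => add_smul_basePt_mem_tube hz hη.le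
  have hsub : MemLp (fun z => h z - F z) (ENNReal.ofReal p) (weightedVolume m α) :=
    ⟨(hhm.sub hFm).aestronglyMeasurable, hclose.trans ENNReal.ofReal_lt_top⟩
  have hhp : MemLp h (ENNReal.ofReal p) (weightedVolume m α) := by
    have := hsub.add hFp
    rwa [show ((fun z => h z - F z) + F) = h by ext z; simp] at this
  obtain ⟨C, N, hC⟩ := exists_norm_translate_le hp hFm hFd hFp hη hη1
  obtain ⟨M, hM⟩ := exists_nat_ge (t + N)
  obtain ⟨δ, hδ, hδclose⟩ := exists_eLpNorm_div_one_add_rho_pow_sub_lt hp hhm hhp M (half_pos hε)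
  set g : (Fin (m + 1) → ℂ) → ℂ := fun z => h z / (1 + (δ : ℂ) * rho z (basePt m)) ^ M
  have hgm : Measurable g := by
    have := (continuous_rho_left (basePt m)).measurable
    simp only [g]
    fun_prop
  have hgdec : g ∈ decaySpace m t := div_one_add_rho_pow_mem_decaySpace hhd hC hM hδ
  have hgp : MemLp g (ENNReal.ofReal p) (weightedVolume m α) := by
    have h1 : MemLp (fun z => g z - h z) (ENNReal.ofReal p) (weightedVolume m α) :=
      ⟨(hgm.sub hhm).aestronglyMeasurable, hδclose.trans ENNReal.ofReal_lt_top⟩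
    have := h1.add hhp
    rwa [show ((fun z => g z - h z) + h) = g by ext z; simp] at this
  refine ⟨⟨g, hgdec.1, hgp⟩, Submodule.mem_comap.2 hgdec, ?_⟩
  have hae2 : (fun z => f z - g z) =ᵐ[weightedVolume m α]
      -((fun z => g z - h z) + fun z => h z - F z) := by
    filter_upwards [hae] with z hz
    simp [← hz]
  show eLpNorm (fun z => f z - g z) _ _ < _
  rw [eLpNorm_congr_ae hae2, eLpNorm_neg]
  refine (eLpNorm_add_le (hgm.sub hhm).aestronglyMeasurable
    (hhm.sub hFm).aestronglyMeasurable hq1).trans_lt ((ENNReal.add_lt_add hδclose hclose).trans_eq ?_)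
  rw [← ENNReal.ofReal_add (by positivity) (by positivity), add_halves]

theorem IsDenseInBergman.mono {m : ℕ} {p α : ℝ} {D E : Submodule ℂ (bergmanSpace m p α)}
    (hD : IsDenseInBergman D) (h : D ≤ E) : IsDenseInBergman E := fun f ε hε => by
  obtain ⟨g, hg, hlt⟩ := hD f ε hε
  exact ⟨g, h hg, hlt⟩

end

theorem theorem5p1 (m : ℕ) (p α t : ℝ) (hp : 1 ≤ p) (hα : -1 < α)
    (ht : (m + 1 : ℝ) + (α + 1) / p < t)
    (μ : MeasureTheory.Measure (Fin (m + 1) → ℂ)) (hμ : μ ∈ MPlus m) :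
    -- `S_t` is a dense subspace of `A^p_α(T_B)`
    decaySpace m t ≤ bergmanSpace m p α ∧
    IsDenseInBergman ((decaySpace m t).submoduleOf (bergmanSpace m p α)) ∧
    -- `T_μ` is densely defined on `A^p_α(T_B)`, and its values are holomorphic
    IsDenseInBergman (toeplitz p α μ).domain ∧
    (∀ f : (toeplitz p α μ).domain, DifferentiableOn ℂ (toeplitz p α μ f) (tube m)) ∧
    -- `T_μ` is defined on `S_t` if `|ρ(·, 𝐢)|^{-t}` is `μ`-integrable, hence on `S_s` for large `s`
    (FiniteMoment μ t →
      (decaySpace m t).submoduleOf (bergmanSpace m p α) ≤ (toeplitz p α μ).domain) ∧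
    (∃ s₀ : ℝ, ∀ s : ℝ, s₀ ≤ s →
      (decaySpace m s).submoduleOf (bergmanSpace m p α) ≤ (toeplitz p α μ).domain) := by
  obtain ⟨s₀, -, hs₀⟩ := hμ
  exact ⟨decaySpace_le_bergmanSpace hp hα ht, isDenseInBergman_decaySpace hp hα t,
    -- Density is taken at the moment exponent `s₀` of `μ`, which may be too small for `S_{s₀} ⊆
    -- A^p_α`; hence the intersection with `A^p_α`.
    (isDenseInBergman_decaySpace hp hα s₀).mono (submoduleOf_le_toeplitz_domain hα hs₀),
    differentiableOn_toeplitz hα, submoduleOf_le_toeplitz_domain hα,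
    s₀, fun s hs => submoduleOf_le_toeplitz_domain hα (hs₀.mono hs)⟩
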